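/- Let $\Sigma=(\Sigma_0,\Sigma_1)$ be a monoidal signature: a set $\Sigma_0$ of generating objects and a set $\Sigma_1$ of operations $d$, each with an arity and a coarity in $\Sigma_0^\star$. A $\Sigma$-string diagram $v\to w$ ($v,w\in\Sigma_0^\star$) is a $\Sigma$-term $v\to w$ (built from operations, identities, symmetries and the empty term by sequential and parallel composition) modulo the laws of strict symmetric monoidal categories; these are the morphisms of $\mathrm{FreeSMC}(\Sigma)$, whose objects are the words in $\Sigma_0^\star$. A $\Sigma$-labelled open hypergraph $v\to w$ is a finite hypergraph $G$, with nodes labelled in $\Sigma_0$, hyperedges labelled in $\Sigma_1$, and a list of sources and a list of targets for each hyperedge whose labels spell the arity and coarity of its label, together with label-preserving maps $f$ and $g$ to the nodes of $G$ from the positions of $v$ and of $w$. Open hypergraphs are considered up to isomorphism (label-preserving, commuting with $f$ and $g$). They are composed sequentially by pushout over the middle interface and in parallel by disjoint union; identities and symmetries are the evident discrete open hypergraphs. The interpretation $[\![-]\!]$ sends an operation to a single hyperedge whose sources and targets are pairwise distinct nodes forming the left and the right interface respectively, and is extended to terms by induction. An open hypergraph is monogamous if $f$ and $g$ are injective, each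 node has in-degree $0$ if it is in the image of $f$ and $1$ otherwise, and each node has out-degree $0$ if it is in the image of $g$ and $1$ otherwise. It is acyclic if there is no directed cycle of hyperedges, where $e$ precedes $e'$ if some target of $e$ is a source of $e'$. Then $\Sigma$-string diagrams are in one-to-one correspondence with $\Sigma$-labelled monogamous acyclic open hypergraphs (up to isomorphism). Precisely: 1. two $\Sigma$-terms $s,t\colon v\to w$ represent the same string diagram if and only if $[\![s]\!]$ and $[\![t]\!]$ are isomorphic open hypergraphs; 2. an open hypergraph $v\to w$ is isomorphic to $[\![t]\!]$ for some $\Sigma$-term $t\colon v\to w$ if and only if it is monogamous and acyclic; 3. the isomorphism classes of monogamous acyclic open hypergraphs form, with the identities, symmetries, sequential and parallel composition of open hypergraphs, a strict symmetric monoidal category $\mathrm{MonHyp}(\Sigma)$ with objects $\Sigma_0^\star$, and $[\![-]\!]$ induces an identity-on-objects isomorphism of strict symmetric monoidal categories $\mathrm{FreeSMC}(\Sigma)\cong\mathrm{MonHyp}(\Sigma)$. -/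

import Mathlib

universe u v w

namespace StrDiag

/-- Transport of a morphism along equalities of its source and target. -/
def castHom {A : Type u} {Hom : A → A → Type v} {a a' b b' : A}
    (ha : a = a') (hb : b = b') (f : Hom a b) : Hom a' b' :=
  ha ▸ hb ▸ f

/-! ### Signatures, terms, string diagrams -/

/-- A monoidal signature: generating objects and operations, each operation having a word of
generating objects as arity and another one as coarity. -/
structure Signature where
  /-- generating objects -/
  Obj : Type u
  /-- operations -/
  Op : Type v
  /-- arity -/
  ar : Op → List Obj
  /-- coarity -/
  coar : Op → List Obj

/-- Terms over a signature, with their types. -/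
inductive Term (S : Signature.{u, v}) : List S.Obj → List S.Obj → Type (max u v)
  | op (d : S.Op) : Term S (S.ar d) (S.coar d)
  | id (x : S.Obj) : Term S [x] [x]
  | sym (x y : S.Obj) : Term S [x, y] [y, x]
  | null : Term S [] []
  | comp {a b c : List S.Obj} (s : Term S a b) (t : Term S b c) : Term S a c
  | par {a b a' b' : List S.Obj} (s : Term S a b) (t : Term S a' b') :
      Term S (a ++ a') (b ++ b')

namespace Term

variable {S : Signature.{u, v}}

/-- The identity term on a word. -/
def idW : (a : List S.Obj) → Term S a a
  | [] => null
  | x :: a => par (id x) (idW a)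

/-- The term crossing one wire `x` over the wires of a word. -/
def symX (x : S.Obj) : (b : List S.Obj) → Term S (x :: b) (b ++ [x])
  | [] => id x
  | y :: b => comp (b := y :: x :: b)
      (par (a := [x, y]) (b := [y, x]) (sym x y) (idW b))
      (par (a := [y]) (b := [y]) (id y) (symX x b))

/-- The symmetry term on two words. -/
def symW : (a b : List S.Obj) → Term S (a ++ b) (b ++ a)
  | [], b => castHom rfl (List.append_nil b).symm (idW b)
  | x :: a, b =>
      castHom rfl (by simp : (b ++ [x]) ++ a = b ++ (x :: a))
        (comp (b := x :: (b ++ a)) (par (a := [x]) (b := [x]) (id x) (symW a b))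
          (par (a := x :: b) (b := b ++ [x]) (symX x b) (idW a)))

/-- Equality of terms modulo the laws of (strict) symmetric monoidal categories: the smallest
congruence containing them. -/
inductive Eqv : {a b : List S.Obj} → Term S a b → Term S a b → Prop
  | refl {a b : List S.Obj} (t : Term S a b) : Eqv t t
  | symm {a b : List S.Obj} {s t : Term S a b} : Eqv s t → Eqv t s
  | trans {a b : List S.Obj} {r s t : Term S a b} : Eqv r s → Eqv s t → Eqv r t
  | comp_congr {a b c : List S.Obj} {s s' : Term S a b} {t t' : Term S b c} :
      Eqv s s' → Eqv t t' → Eqv (comp s t) (comp s' t')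
  | par_congr {a b a' b' : List S.Obj} {s s' : Term S a b} {t t' : Term S a' b'} :
      Eqv s s' → Eqv t t' → Eqv (par s t) (par s' t')
  | assoc {a b c d : List S.Obj} (r : Term S a b) (s : Term S b c) (t : Term S c d) :
      Eqv (comp (comp r s) t) (comp r (comp s t))
  | id_comp {a b : List S.Obj} (t : Term S a b) : Eqv (comp (idW a) t) t
  | comp_id {a b : List S.Obj} (t : Term S a b) : Eqv (comp t (idW b)) t
  | interchange {a b c a' b' c' : List S.Obj} (s : Term S a b) (t : Term S b c)
      (s' : Term S a' b') (t' : Term S b' c') :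
      Eqv (comp (par s s') (par t t')) (par (comp s t) (comp s' t'))
  | par_assoc {a b a' b' a'' b'' : List S.Obj} (r : Term S a b) (s : Term S a' b')
      (t : Term S a'' b'') :
      Eqv (castHom (List.append_assoc a a' a'') (List.append_assoc b b' b'')
        (par (par r s) t)) (par r (par s t))
  | null_par {a b : List S.Obj} (t : Term S a b) : Eqv (par null t) t
  | par_null {a b : List S.Obj} (t : Term S a b) :
      Eqv (castHom (List.append_nil a) (List.append_nil b) (par t null)) t
  | sym_natural (a : List S.Obj) {b c : List S.Obj} (t : Term S b c) :
      Eqv (comp (par (idW a) t) (symW a c)) (comp (symW a b) (par t (idW a)))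
  | sym_iso (a b : List S.Obj) :
      Eqv (comp (symW a b) (symW b a)) (par (idW a) (idW b))

/-- Equality modulo the laws, as a setoid. -/
instance setoid (a b : List S.Obj) : Setoid (Term S a b) where
  r := Eqv
  iseqv := ⟨Eqv.refl, Eqv.symm, Eqv.trans⟩

end Term

/-- String diagrams: terms modulo the laws of symmetric monoidal categories. -/
def Diagram (S : Signature.{u, v}) (a b : List S.Obj) : Type (max u v) :=
  Quotient (Term.setoid a b)

/-- The string diagram of a term. -/
def Diagram.mk {S : Signature.{u, v}} {a b : List S.Obj} (t : Term S a b) : Diagram S a b :=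
  Quotient.mk _ t

/-! ### Strict symmetric monoidal categories whose monoid of objects is free -/

/-- A strict symmetric monoidal category with the words over `A` as objects, concatenation as
the product of objects, and the given sets of morphisms; composition is in diagrammatic order. -/
structure StrictSMC {A : Type u} (Hom : List A → List A → Type v) where
  id : (a : List A) → Hom a a
  comp : {a b c : List A} → Hom a b → Hom b c → Hom a c
  tensor : {a b a' b' : List A} → Hom a b → Hom a' b' → Hom (a ++ a') (b ++ b')
  symm : (a b : List A) → Hom (a ++ b) (b ++ a)
  id_comp : ∀ {a b : List A} (f : Hom a b), comp (id a) f = f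
  comp_id : ∀ {a b : List A} (f : Hom a b), comp f (id b) = f
  assoc : ∀ {a b c d : List A} (f : Hom a b) (g : Hom b c) (h : Hom c d),
    comp (comp f g) h = comp f (comp g h)
  tensor_id : ∀ a b : List A, tensor (id a) (id b) = id (a ++ b)
  interchange : ∀ {a b c a' b' c' : List A} (f : Hom a b) (g : Hom b c)
    (f' : Hom a' b') (g' : Hom b' c'),
    comp (tensor f f') (tensor g g') = tensor (comp f g) (comp f' g')
  tensor_assoc : ∀ {a b a' b' a'' b'' : List A} (f : Hom a b) (g : Hom a' b')
    (h : Hom a'' b''),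
    castHom (List.append_assoc a a' a'') (List.append_assoc b b' b'')
      (tensor (tensor f g) h) = tensor f (tensor g h)
  id_nil_tensor : ∀ {a b : List A} (f : Hom a b), tensor (id []) f = f
  tensor_id_nil : ∀ {a b : List A} (f : Hom a b),
    castHom (List.append_nil a) (List.append_nil b) (tensor f (id [])) = f
  symm_natural : ∀ (a : List A) {b c : List A} (f : Hom b c),
    comp (tensor (id a) f) (symm a c) = comp (symm a b) (tensor f (id a))
  symm_symm : ∀ a b : List A, comp (symm a b) (symm b a) = tensor (id a) (id b)
  hexagon : ∀ a b c : List A,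
    castHom (List.append_assoc a b c) (List.append_assoc c a b).symm (symm (a ++ b) c) =
      comp (castHom rfl (List.append_assoc a c b).symm (tensor (id a) (symm b c)))
        (tensor (symm a c) (id b))

/-- An isomorphism of strict symmetric monoidal categories that is the identity on objects:
a strict symmetric monoidal functor bijective on morphisms. -/
structure StrictSMC.Iso {A : Type u} {Hom : List A → List A → Type v}
    {Hom' : List A → List A → Type w} (C : StrictSMC Hom) (D : StrictSMC Hom') where
  map : (a b : List A) → Hom a b ≃ Hom' a b
  map_id : ∀ a, map a a (C.id a) = D.id a
  map_comp : ∀ {a b c : List A} (f : Hom a b) (g : Hom b c),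
    map a c (C.comp f g) = D.comp (map a b f) (map b c g)
  map_tensor : ∀ {a b a' b' : List A} (f : Hom a b) (g : Hom a' b'),
    map _ _ (C.tensor f g) = D.tensor (map a b f) (map a' b' g)
  map_symm : ∀ a b : List A, map _ _ (C.symm a b) = D.symm a b

/-! ### The free symmetric monoidal category -/

namespace Diagram

variable {S : Signature.{u, v}}

/-- Sequential composition of string diagrams. -/
def comp {a b c : List S.Obj} (f : Diagram S a b) (g : Diagram S b c) : Diagram S a c :=
  Quotient.map₂ Term.comp (fun _ _ h _ _ k => Term.Eqv.comp_congr h k) f g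

/-- Parallel composition of string diagrams. -/
def par {a b a' b' : List S.Obj} (f : Diagram S a b) (g : Diagram S a' b') :
    Diagram S (a ++ a') (b ++ b') :=
  Quotient.map₂ Term.par (fun _ _ h _ _ k => Term.Eqv.par_congr h k) f g

/-- The string diagram of parallel wires. -/
def idW (a : List S.Obj) : Diagram S a a := mk (Term.idW a)

/-- The string diagram of a bundle of wires crossing another one. -/
def symW (a b : List S.Obj) : Diagram S (a ++ b) (b ++ a) := mk (Term.symW a b)

theorem mk_castHom {a a' b b' : List S.Obj} (ha : a = a') (hb : b = b') (t : Term S a b) :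
    mk (castHom ha hb t) = castHom ha hb (mk t) := by
  subst ha hb; rfl

theorem castHom_heq {A : Type u} {Hom : A → A → Type v} {a a' b b' : A}
    (ha : a = a') (hb : b = b') (f : Hom a b) : HEq (castHom ha hb f) f := by
  subst ha hb; rfl

theorem comp_heq {a b c a' b' c' : List S.Obj} (ha : a = a') (hb : b = b') (hc : c = c')
    {f : Diagram S a b} {g : Diagram S b c} {f' : Diagram S a' b'} {g' : Diagram S b' c'}
    (hf : HEq f f') (hg : HEq g g') : HEq (comp f g) (comp f' g') := by
  subst ha hb hc; cases hf; cases hg; rfl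

theorem par_heq {a b c d a' b' c' d' : List S.Obj} (ha : a = a') (hb : b = b') (hc : c = c')
    (hd : d = d')
    {f : Diagram S a b} {g : Diagram S c d} {f' : Diagram S a' b'} {g' : Diagram S c' d'}
    (hf : HEq f f') (hg : HEq g g') : HEq (par f g) (par f' g') := by
  subst ha hb hc hd; cases hf; cases hg; rfl

theorem interchange {a b c a' b' c' : List S.Obj} (f : Diagram S a b) (g : Diagram S b c)
    (f' : Diagram S a' b') (g' : Diagram S b' c') :
    comp (par f f') (par g g') = par (comp f g) (comp f' g') := by
  induction f using Quotient.inductionOn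
  induction g using Quotient.inductionOn
  induction f' using Quotient.inductionOn
  induction g' using Quotient.inductionOn
  exact Quotient.sound (Term.Eqv.interchange _ _ _ _)

theorem id_comp {a b : List S.Obj} (f : Diagram S a b) : comp (idW a) f = f := by
  induction f using Quotient.inductionOn
  exact Quotient.sound (Term.Eqv.id_comp _)

theorem comp_id {a b : List S.Obj} (f : Diagram S a b) : comp f (idW b) = f := by
  induction f using Quotient.inductionOn
  exact Quotient.sound (Term.Eqv.comp_id _)

theorem assoc {a b c d : List S.Obj} (f : Diagram S a b) (g : Diagram S b c)
    (h : Diagram S c d) : comp (comp f g) h = comp f (comp g h) := by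
  induction f using Quotient.inductionOn
  induction g using Quotient.inductionOn
  induction h using Quotient.inductionOn
  exact Quotient.sound (Term.Eqv.assoc _ _ _)

theorem par_assoc {a b a' b' a'' b'' : List S.Obj} (f : Diagram S a b) (g : Diagram S a' b')
    (h : Diagram S a'' b'') :
    castHom (List.append_assoc a a' a'') (List.append_assoc b b' b'') (par (par f g) h) =
      par f (par g h) := by
  induction f using Quotient.inductionOn
  induction g using Quotient.inductionOn
  induction h using Quotient.inductionOn
  exact (mk_castHom _ _ _).symm.trans (Quotient.sound (Term.Eqv.par_assoc _ _ _))

theorem par_assoc_heq {a b a' b' a'' b'' : List S.Obj} (f : Diagram S a b)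
    (g : Diagram S a' b') (h : Diagram S a'' b'') :
    HEq (par (par f g) h) (par f (par g h)) := by
  rw [← par_assoc]; exact (castHom_heq _ _ _).symm

theorem null_par {a b : List S.Obj} (f : Diagram S a b) : par (idW []) f = f := by
  induction f using Quotient.inductionOn
  exact Quotient.sound (Term.Eqv.null_par _)

theorem par_null {a b : List S.Obj} (f : Diagram S a b) :
    castHom (List.append_nil a) (List.append_nil b) (par f (idW [])) = f := by
  induction f using Quotient.inductionOn
  exact (mk_castHom _ _ _).symm.trans (Quotient.sound (Term.Eqv.par_null _))

theorem par_id (a b : List S.Obj) : par (idW a) (idW b) = idW (a ++ b) := by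
  induction a with
  | nil => exact null_par _
  | cons x a ih =>
    have h := par_assoc_heq (mk (Term.id x)) (idW a) (idW b)
    rw [ih] at h
    exact eq_of_heq h

theorem sym_natural (a : List S.Obj) {b c : List S.Obj} (f : Diagram S b c) :
    comp (par (idW a) f) (symW a c) = comp (symW a b) (par f (idW a)) := by
  induction f using Quotient.inductionOn
  exact Quotient.sound (Term.Eqv.sym_natural _ _)

theorem sym_iso (a b : List S.Obj) : comp (symW a b) (symW b a) = par (idW a) (idW b) :=
  Quotient.sound (Term.Eqv.sym_iso _ _)

theorem symW_cons (x : S.Obj) (a b : List S.Obj) :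
    HEq (symW (x :: a) b)
      (comp (b := x :: (b ++ a)) (par (a := [x]) (b := [x]) (mk (Term.id x)) (symW a b))
        (par (a := x :: b) (b := b ++ [x]) (mk (Term.symX x b)) (idW a))) := by
  have h : symW (x :: a) b = castHom rfl (by simp : (b ++ [x]) ++ a = b ++ (x :: a))
      (mk (Term.comp (b := x :: (b ++ a))
        (Term.par (a := [x]) (b := [x]) (Term.id x) (Term.symW a b))
        (Term.par (a := x :: b) (b := b ++ [x]) (Term.symX x b) (Term.idW a)))) :=
    mk_castHom _ _ _
  rw [h]
  exact castHom_heq _ _ _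

theorem symW_append_heq (a b c : List S.Obj) :
    HEq (symW (a ++ b) c)
      (comp (b := a ++ (c ++ b)) (par (idW a) (symW b c))
        (castHom (List.append_assoc a c b) rfl (par (symW a c) (idW b)))) := by
  induction a with
  | nil =>
    have h0 : HEq (symW [] c) (idW c) := by
      have h : symW [] c = castHom rfl (List.append_nil c).symm (idW c) := mk_castHom _ _ _
      rw [h]; exact castHom_heq _ _ _
    have h1 : HEq (castHom (List.append_assoc [] c b) rfl (par (symW [] c) (idW b)))
        (idW (c ++ b)) := by
      rw [← par_id]
      exact (castHom_heq _ _ _).trans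
        (par_heq rfl (List.append_nil c) rfl rfl h0 HEq.rfl)
    refine HEq.symm ((comp_heq (b := c ++ b) (b' := c ++ b) (a' := b ++ c) (c' := c ++ b)
      rfl rfl (by simp) (heq_of_eq (null_par (symW b c))) h1).trans ?_)
    exact heq_of_eq (comp_id (symW b c))
  | cons x a ih =>
    let ix : Diagram S [x] [x] := mk (Term.id x)
    let sx : Diagram S (x :: c) (c ++ [x]) := mk (Term.symX x c)
    have hix : comp ix ix = ix := by
      have h : ix = idW [x] := by
        have h := par_null ix
        exact h.symm
      rw [h]; exact id_comp _
    let P : Diagram S (a ++ (b ++ c)) (a ++ (c ++ b)) := par (idW a) (symW b c)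
    let Q : Diagram S ((a ++ c) ++ b) ((c ++ a) ++ b) := par (symW a c) (idW b)
    let Q' : Diagram S (a ++ (c ++ b)) ((c ++ a) ++ b) :=
      castHom (List.append_assoc a c b) rfl Q
    have hQ : HEq Q' Q := castHom_heq _ _ _
    let U : Diagram S (x :: (a ++ c)) (x :: (c ++ a)) :=
      par (a := [x]) (b := [x]) ix (symW a c)
    let V : Diagram S (x :: (c ++ a)) ((c ++ [x]) ++ a) :=
      par (a := x :: c) (b := c ++ [x]) sx (idW a)
    let R : Diagram S (x :: (c ++ (a ++ b))) ((c ++ [x]) ++ (a ++ b)) :=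
      par (a := x :: c) (b := c ++ [x]) sx (idW (a ++ b))
    have hR : HEq (par V (idW b)) R := by
      have h := par_assoc_heq sx (idW a) (idW b)
      rw [par_id] at h
      exact h
    have hU : HEq (par U (idW b)) (par (a := [x]) (b := [x]) ix Q) :=
      par_assoc_heq ix (symW a c) (idW b)
    have hL : HEq (symW (x :: (a ++ b)) c)
        (comp (b := x :: ((c ++ a) ++ b))
          (par (a := [x]) (b := [x]) ix (comp P Q')) (par V (idW b))) :=
      (symW_cons x (a ++ b) c).trans
        (comp_heq (by simp) (by simp) (by simp)
          (par_heq rfl rfl (by simp) (by simp) HEq.rfl ih) hR.symm)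
    have hM : comp (b := x :: ((c ++ a) ++ b))
          (par (a := [x]) (b := [x]) ix (comp P Q')) (par V (idW b)) =
        comp (b := x :: (a ++ (c ++ b))) (par (a := [x]) (b := [x]) ix P)
          (comp (b := x :: ((c ++ a) ++ b)) (par (a := [x]) (b := [x]) ix Q')
            (par V (idW b))) := by
      have h := interchange ix ix P Q'
      rw [hix] at h
      rw [← h]
      exact assoc _ _ _
    have hN : HEq (comp (b := x :: ((c ++ a) ++ b)) (par (a := [x]) (b := [x]) ix Q')
            (par V (idW b))) (par (comp U V) (idW b)) := by
      have h := interchange U V (idW b) (idW b)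
      rw [id_comp] at h
      rw [← h]
      refine comp_heq (by simp) rfl rfl ?_ HEq.rfl
      exact (par_heq rfl rfl (by simp) rfl HEq.rfl hQ).trans hU.symm
    have hS : HEq (par (symW (x :: a) c) (idW b)) (par (comp U V) (idW b)) :=
      par_heq rfl (by simp) rfl rfl (symW_cons x a c) HEq.rfl
    refine hL.trans ((heq_of_eq hM).trans ?_)
    refine comp_heq (by simp) rfl (by simp) ?_ ?_
    · exact (par_assoc_heq ix (idW a) (symW b c)).symm
    · exact hN.trans (hS.symm.trans (castHom_heq _ _ _).symm)

/-- Compatibility of the symmetries of string diagrams with concatenation of words. -/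
theorem hexagon (a b c : List S.Obj) :
    castHom (List.append_assoc a b c) (List.append_assoc c a b).symm (symW (a ++ b) c) =
      comp (castHom rfl (List.append_assoc a c b).symm (par (idW a) (symW b c)))
        (par (symW a c) (idW b)) := by
  refine eq_of_heq ((castHom_heq _ _ _).trans ((symW_append_heq a b c).trans ?_))
  exact comp_heq rfl (List.append_assoc a c b).symm rfl (castHom_heq _ _ _).symm
    (castHom_heq _ _ _)

end Diagram

/-- The free strict symmetric monoidal category on a signature: objects are words of generating
objects, morphisms are string diagrams. -/
def freeSMC (S : Signature.{u, v}) : StrictSMC (Diagram S) where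
  id := Diagram.idW
  comp := Diagram.comp
  tensor := Diagram.par
  symm := Diagram.symW
  id_comp := Diagram.id_comp
  comp_id := Diagram.comp_id
  assoc := Diagram.assoc
  tensor_id := Diagram.par_id
  interchange := Diagram.interchange
  tensor_assoc := Diagram.par_assoc
  id_nil_tensor := Diagram.null_par
  tensor_id_nil := Diagram.par_null
  symm_natural := Diagram.sym_natural
  symm_symm := Diagram.sym_iso
  hexagon := Diagram.hexagon

/-! ### Open hypergraphs -/

/-- A finite hypergraph with nodes labelled by generating objects and hyperedges labelled by
operations; the labels of the sources (targets) of a hyperedge spell the arity (coarity) of its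
label. -/
structure Hypergraph (S : Signature.{u, v}) where
  Node : Type
  Edge : Type
  finite_node : Finite Node
  finite_edge : Finite Edge
  nodeLabel : Node → S.Obj
  edgeLabel : Edge → S.Op
  src : Edge → List Node
  tgt : Edge → List Node
  src_label : ∀ e, (src e).map nodeLabel = S.ar (edgeLabel e)
  tgt_label : ∀ e, (tgt e).map nodeLabel = S.coar (edgeLabel e)

/-- An open hypergraph with left interface `a` and right interface `b`: a hypergraph `G` with
label-preserving maps to its nodes from the positions of the word `a` and from the positions of
the word `b` (a cospan from the discrete hypergraph on `a` to the discrete hypergraph on `b`).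
A map from the positions of a word is written as the list of its values. -/
structure OpenHypergraph (S : Signature.{u, v}) (a b : List S.Obj) extends Hypergraph S where
  left : List Node
  right : List Node
  left_label : left.map nodeLabel = a
  right_label : right.map nodeLabel = b

namespace OpenHypergraph

variable {S : Signature.{u, v}}

/-- Isomorphisms of open hypergraphs: isomorphisms of labelled hypergraphs that commute with
the maps from the interfaces. -/
structure Iso {a b : List S.Obj} (G H : OpenHypergraph S a b) where
  node : G.Node ≃ H.Node
  edge : G.Edge ≃ H.Edge
  nodeLabel_eq : ∀ x, H.nodeLabel (node x) = G.nodeLabel x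
  edgeLabel_eq : ∀ e, H.edgeLabel (edge e) = G.edgeLabel e
  src_eq : ∀ e, H.src (edge e) = (G.src e).map node
  tgt_eq : ∀ e, H.tgt (edge e) = (G.tgt e).map node
  left_eq : H.left = G.left.map node
  right_eq : H.right = G.right.map node

/-- The identity isomorphism. -/
def Iso.refl {a b : List S.Obj} (G : OpenHypergraph S a b) : Iso G G where
  node := Equiv.refl _
  edge := Equiv.refl _
  nodeLabel_eq _ := rfl
  edgeLabel_eq _ := rfl
  src_eq _ := by simp
  tgt_eq _ := by simp
  left_eq := by simp
  right_eq := by simp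

/-- The inverse isomorphism. -/
def Iso.symm {a b : List S.Obj} {G H : OpenHypergraph S a b} (i : Iso G H) : Iso H G where
  node := i.node.symm
  edge := i.edge.symm
  nodeLabel_eq x := by rw [← i.nodeLabel_eq]; simp
  edgeLabel_eq e := by rw [← i.edgeLabel_eq]; simp
  src_eq e := by
    have h := i.src_eq (i.edge.symm e)
    rw [Equiv.apply_symm_apply] at h
    rw [h]; simp
  tgt_eq e := by
    have h := i.tgt_eq (i.edge.symm e)
    rw [Equiv.apply_symm_apply] at h
    rw [h]; simp
  left_eq := by rw [i.left_eq]; simp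
  right_eq := by rw [i.right_eq]; simp

/-- Composition of isomorphisms. -/
def Iso.trans {a b : List S.Obj} {G H K : OpenHypergraph S a b} (i : Iso G H) (j : Iso H K) :
    Iso G K where
  node := i.node.trans j.node
  edge := i.edge.trans j.edge
  nodeLabel_eq x := by simp [j.nodeLabel_eq, i.nodeLabel_eq]
  edgeLabel_eq e := by simp [j.edgeLabel_eq, i.edgeLabel_eq]
  src_eq e := by simp [j.src_eq, i.src_eq]
  tgt_eq e := by simp [j.tgt_eq, i.tgt_eq]
  left_eq := by simp [j.left_eq, i.left_eq]
  right_eq := by simp [j.right_eq, i.right_eq]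

/-- Isomorphism of open hypergraphs, as a setoid. -/
instance setoid (a b : List S.Obj) : Setoid (OpenHypergraph S a b) where
  r G H := Nonempty (Iso G H)
  iseqv := ⟨fun G => ⟨Iso.refl G⟩, fun ⟨i⟩ => ⟨i.symm⟩, fun ⟨i⟩ ⟨j⟩ => ⟨i.trans j⟩⟩

/-- The discrete open hypergraph on a word, with identity maps from both interfaces. -/
def idW (a : List S.Obj) : OpenHypergraph S a a where
  Node := Fin a.length
  Edge := Empty
  finite_node := inferInstance
  finite_edge := inferInstance
  nodeLabel := a.get
  edgeLabel := Empty.elim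
  src := Empty.elim
  tgt := Empty.elim
  src_label e := e.elim
  tgt_label e := e.elim
  left := List.finRange a.length
  right := List.finRange a.length
  left_label := by simp
  right_label := by simp

/-- The discrete open hypergraph on the concatenation of `a` and `b`, with the two parts in the
opposite order on the right interface. -/
def symW (a b : List S.Obj) : OpenHypergraph S (a ++ b) (b ++ a) where
  Node := Fin a.length ⊕ Fin b.length
  Edge := Empty
  finite_node := inferInstance
  finite_edge := inferInstance
  nodeLabel := Sum.elim a.get b.get
  edgeLabel := Empty.elim
  src := Empty.elim
  tgt := Empty.elim
  src_label e := e.elim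
  tgt_label e := e.elim
  left := (List.finRange a.length).map Sum.inl ++ (List.finRange b.length).map Sum.inr
  right := (List.finRange b.length).map Sum.inr ++ (List.finRange a.length).map Sum.inl
  left_label := by simp
  right_label := by simp

/-- The open hypergraph of an operation: one hyperedge, whose sources are the left interface and
whose targets are the right interface, all of them distinct. -/
def op (d : S.Op) : OpenHypergraph S (S.ar d) (S.coar d) where
  Node := Fin (S.ar d).length ⊕ Fin (S.coar d).length
  Edge := Unit
  finite_node := inferInstance
  finite_edge := inferInstance
  nodeLabel := Sum.elim (S.ar d).get (S.coar d).get
  edgeLabel _ := d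
  src _ := (List.finRange (S.ar d).length).map Sum.inl
  tgt _ := (List.finRange (S.coar d).length).map Sum.inr
  src_label _ := by simp
  tgt_label _ := by simp
  left := (List.finRange (S.ar d).length).map Sum.inl
  right := (List.finRange (S.coar d).length).map Sum.inr
  left_label := by simp
  right_label := by simp

/-- Parallel composition: disjoint union. -/
def par {a b a' b' : List S.Obj} (G : OpenHypergraph S a b) (H : OpenHypergraph S a' b') :
    OpenHypergraph S (a ++ a') (b ++ b') where
  Node := G.Node ⊕ H.Node
  Edge := G.Edge ⊕ H.Edge
  finite_node := have := G.finite_node; have := H.finite_node; inferInstance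
  finite_edge := have := G.finite_edge; have := H.finite_edge; inferInstance
  nodeLabel := Sum.elim G.nodeLabel H.nodeLabel
  edgeLabel := Sum.elim G.edgeLabel H.edgeLabel
  src := Sum.elim (fun e => (G.src e).map Sum.inl) (fun e => (H.src e).map Sum.inr)
  tgt := Sum.elim (fun e => (G.tgt e).map Sum.inl) (fun e => (H.tgt e).map Sum.inr)
  src_label := by
    rintro (e | e)
    · simpa using G.src_label e
    · simpa using H.src_label e
  tgt_label := by
    rintro (e | e)
    · simpa using G.tgt_label e
    · simpa using H.tgt_label e
  left := G.left.map Sum.inl ++ H.left.map Sum.inr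
  right := G.right.map Sum.inl ++ H.right.map Sum.inr
  left_label := by simpa using congrArg₂ (· ++ ·) G.left_label H.left_label
  right_label := by simpa using congrArg₂ (· ++ ·) G.right_label H.right_label

/-- The relation on the disjoint union of nodes that relates, for each position of the middle
interface, its image in `G` and its image in `H`. -/
def Glue {a b c : List S.Obj} (G : OpenHypergraph S a b) (H : OpenHypergraph S b c)
    (p q : G.Node ⊕ H.Node) : Prop :=
  ∃ (i : ℕ) (x : G.Node) (y : H.Node),
    G.right[i]? = some x ∧ H.left[i]? = some y ∧ p = Sum.inl x ∧ q = Sum.inr y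

theorem Glue.label_eq {a b c : List S.Obj} {G : OpenHypergraph S a b} {H : OpenHypergraph S b c}
    {p q : G.Node ⊕ H.Node} (h : Glue G H p q) :
    Sum.elim G.nodeLabel H.nodeLabel p = Sum.elim G.nodeLabel H.nodeLabel q := by
  obtain ⟨i, x, y, hx, hy, rfl, rfl⟩ := h
  have h1 : (G.right.map G.nodeLabel)[i]? = some (G.nodeLabel x) := by simp [hx]
  have h2 : (H.left.map H.nodeLabel)[i]? = some (H.nodeLabel y) := by simp [hy]
  rw [G.right_label] at h1
  rw [H.left_label, h1] at h2
  exact Option.some.inj h2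

/-- Sequential composition: the pushout over the middle interface. The nodes are the quotient of
the disjoint union by the equivalence relation generated by `Glue`, the hyperedges are the
disjoint union. -/
def comp {a b c : List S.Obj} (G : OpenHypergraph S a b) (H : OpenHypergraph S b c) :
    OpenHypergraph S a c where
  Node := Quot (Glue G H)
  Edge := G.Edge ⊕ H.Edge
  finite_node := have := G.finite_node; have := H.finite_node; inferInstance
  finite_edge := have := G.finite_edge; have := H.finite_edge; inferInstance
  nodeLabel := Quot.lift (Sum.elim G.nodeLabel H.nodeLabel) (fun _ _ h => h.label_eq)
  edgeLabel := Sum.elim G.edgeLabel H.edgeLabel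
  src := Sum.elim (fun e => (G.src e).map fun x => Quot.mk _ (Sum.inl x))
    (fun e => (H.src e).map fun x => Quot.mk _ (Sum.inr x))
  tgt := Sum.elim (fun e => (G.tgt e).map fun x => Quot.mk _ (Sum.inl x))
    (fun e => (H.tgt e).map fun x => Quot.mk _ (Sum.inr x))
  src_label := by
    rintro (e | e)
    · simpa [Function.comp_def] using G.src_label e
    · simpa [Function.comp_def] using H.src_label e
  tgt_label := by
    rintro (e | e)
    · simpa [Function.comp_def] using G.tgt_label e
    · simpa [Function.comp_def] using H.tgt_label e
  left := G.left.map fun x => Quot.mk _ (Sum.inl x)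
  right := H.right.map fun x => Quot.mk _ (Sum.inr x)
  left_label := by simpa [Function.comp_def] using G.left_label
  right_label := by simpa [Function.comp_def] using H.right_label

/-- The in-degree of a node: the number of pairs of a hyperedge `e` and a position `i` such that
the node is the `i`-th target of `e`. -/
noncomputable def inDegree {a b : List S.Obj} (G : OpenHypergraph S a b) (x : G.Node) : ℕ :=
  Nat.card {p : G.Edge × ℕ // (G.tgt p.1)[p.2]? = some x}

/-- The out-degree of a node: the number of pairs of a hyperedge `e` and a position `i` such that
the node is the `i`-th source of `e`. -/
noncomputable def outDegree {a b : List S.Obj} (G : OpenHypergraph S a b) (x : G.Node) : ℕ :=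
  Nat.card {p : G.Edge × ℕ // (G.src p.1)[p.2]? = some x}

/-- Monogamy: the maps from the interfaces are injective, a node has in-degree `0` if it is in
the image of the left interface and `1` otherwise, and out-degree `0` if it is in the image of the
right interface and `1` otherwise. -/
structure Monogamous {a b : List S.Obj} (G : OpenHypergraph S a b) : Prop where
  left_injective : G.left.Nodup
  right_injective : G.right.Nodup
  inDegree_of_mem : ∀ x ∈ G.left, G.inDegree x = 0
  inDegree_of_notMem : ∀ x ∉ G.left, G.inDegree x = 1
  outDegree_of_mem : ∀ x ∈ G.right, G.outDegree x = 0
  outDegree_of_notMem : ∀ x ∉ G.right, G.outDegree x = 1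

/-- Some target of the hyperedge `e` is a source of the hyperedge `e'`. -/
def Precedes {a b : List S.Obj} (G : OpenHypergraph S a b) (e e' : G.Edge) : Prop :=
  ∃ x, x ∈ G.tgt e ∧ x ∈ G.src e'

/-- There is no directed cycle. -/
def Acyclic {a b : List S.Obj} (G : OpenHypergraph S a b) : Prop :=
  ∀ e, ¬ Relation.TransGen G.Precedes e e

theorem Iso.mem_map {a b : List S.Obj} {G H : OpenHypergraph S a b} (i : Iso G H) (x : G.Node)
    (l : List G.Node) : i.node x ∈ l.map i.node ↔ x ∈ l := by simp

theorem Iso.inDegree_eq {a b : List S.Obj} {G H : OpenHypergraph S a b} (i : Iso G H)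
    (x : G.Node) : H.inDegree (i.node x) = G.inDegree x := by
  refine (Nat.card_congr ((i.edge.prodCongr (Equiv.refl ℕ)).subtypeEquiv ?_)).symm
  rintro ⟨e, n⟩
  simp [i.tgt_eq]

theorem Iso.outDegree_eq {a b : List S.Obj} {G H : OpenHypergraph S a b} (i : Iso G H)
    (x : G.Node) : H.outDegree (i.node x) = G.outDegree x := by
  refine (Nat.card_congr ((i.edge.prodCongr (Equiv.refl ℕ)).subtypeEquiv ?_)).symm
  rintro ⟨e, n⟩
  simp [i.src_eq]

theorem Iso.monogamous {a b : List S.Obj} {G H : OpenHypergraph S a b} (i : Iso G H)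
    (h : G.Monogamous) : H.Monogamous where
  left_injective := by rw [i.left_eq]; exact h.left_injective.map i.node.injective
  right_injective := by rw [i.right_eq]; exact h.right_injective.map i.node.injective
  inDegree_of_mem := by
    intro y hy
    obtain ⟨x, rfl⟩ := i.node.surjective y
    rw [i.left_eq, i.mem_map] at hy
    rw [i.inDegree_eq]; exact h.inDegree_of_mem x hy
  inDegree_of_notMem := by
    intro y hy
    obtain ⟨x, rfl⟩ := i.node.surjective y
    rw [i.left_eq, i.mem_map] at hy
    rw [i.inDegree_eq]; exact h.inDegree_of_notMem x hy
  outDegree_of_mem := by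
    intro y hy
    obtain ⟨x, rfl⟩ := i.node.surjective y
    rw [i.right_eq, i.mem_map] at hy
    rw [i.outDegree_eq]; exact h.outDegree_of_mem x hy
  outDegree_of_notMem := by
    intro y hy
    obtain ⟨x, rfl⟩ := i.node.surjective y
    rw [i.right_eq, i.mem_map] at hy
    rw [i.outDegree_eq]; exact h.outDegree_of_notMem x hy

theorem Iso.acyclic {a b : List S.Obj} {G H : OpenHypergraph S a b} (i : Iso G H)
    (h : G.Acyclic) : H.Acyclic := by
  intro e he
  refine h (i.symm.edge e) (he.lift i.symm.edge ?_)
  rintro e₁ e₂ ⟨x, h₁, h₂⟩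
  refine ⟨i.symm.node x, ?_, ?_⟩
  · rw [i.symm.tgt_eq]; exact List.mem_map_of_mem h₁
  · rw [i.symm.src_eq]; exact List.mem_map_of_mem h₂

/-- Parallel composition respects isomorphism. -/
def Iso.par {a b a' b' : List S.Obj} {G G' : OpenHypergraph S a b} {H H' : OpenHypergraph S a' b'}
    (i : Iso G G') (j : Iso H H') : Iso (G.par H) (G'.par H') where
  node := i.node.sumCongr j.node
  edge := i.edge.sumCongr j.edge
  nodeLabel_eq := by
    rintro (x | x)
    · exact i.nodeLabel_eq x
    · exact j.nodeLabel_eq x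
  edgeLabel_eq := by
    rintro (x | x)
    · exact i.edgeLabel_eq x
    · exact j.edgeLabel_eq x
  src_eq := by
    rintro (e | e)
    · refine (congrArg (List.map _) (i.src_eq e)).trans ?_
      simp only [OpenHypergraph.par, Sum.elim_inl, List.map_map]
      rfl
    · refine (congrArg (List.map _) (j.src_eq e)).trans ?_
      simp only [OpenHypergraph.par, Sum.elim_inr, List.map_map]
      rfl
  tgt_eq := by
    rintro (e | e)
    · refine (congrArg (List.map _) (i.tgt_eq e)).trans ?_
      simp only [OpenHypergraph.par, Sum.elim_inl, List.map_map]
      rfl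
    · refine (congrArg (List.map _) (j.tgt_eq e)).trans ?_
      simp only [OpenHypergraph.par, Sum.elim_inr, List.map_map]
      rfl
  left_eq := by
    simp only [OpenHypergraph.par, i.left_eq, j.left_eq, List.map_append, List.map_map]
    rfl
  right_eq := by
    simp only [OpenHypergraph.par, i.right_eq, j.right_eq, List.map_append, List.map_map]
    rfl

/-- Sequential composition respects isomorphism. -/
def Iso.comp {a b c : List S.Obj} {G G' : OpenHypergraph S a b} {H H' : OpenHypergraph S b c}
    (i : Iso G G') (j : Iso H H') : Iso (G.comp H) (G'.comp H') where
  node := Quot.congr (i.node.sumCongr j.node) (by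
    rintro (x | x) (y | y) <;> simp [Glue, i.right_eq, j.left_eq])
  edge := i.edge.sumCongr j.edge
  nodeLabel_eq := by
    rintro ⟨x | x⟩
    · exact i.nodeLabel_eq x
    · exact j.nodeLabel_eq x
  edgeLabel_eq := by
    rintro (x | x)
    · exact i.edgeLabel_eq x
    · exact j.edgeLabel_eq x
  src_eq := by
    rintro (e | e)
    · refine (congrArg (List.map _) (i.src_eq e)).trans ?_
      simp only [OpenHypergraph.comp, Sum.elim_inl, List.map_map]
      rfl
    · refine (congrArg (List.map _) (j.src_eq e)).trans ?_
      simp only [OpenHypergraph.comp, Sum.elim_inr, List.map_map]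
      rfl
  tgt_eq := by
    rintro (e | e)
    · refine (congrArg (List.map _) (i.tgt_eq e)).trans ?_
      simp only [OpenHypergraph.comp, Sum.elim_inl, List.map_map]
      rfl
    · refine (congrArg (List.map _) (j.tgt_eq e)).trans ?_
      simp only [OpenHypergraph.comp, Sum.elim_inr, List.map_map]
      rfl
  left_eq := by
    simp only [OpenHypergraph.comp, i.left_eq, List.map_map]
    rfl
  right_eq := by
    simp only [OpenHypergraph.comp, j.right_eq, List.map_map]
    rfl

end OpenHypergraph

/-- The interpretation of terms as open hypergraphs, by induction on terms. -/
def Term.interp {S : Signature.{u, v}} :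
    {a b : List S.Obj} → Term S a b → OpenHypergraph S a b
  | _, _, .op d => OpenHypergraph.op d
  | _, _, .id x => OpenHypergraph.idW [x]
  | _, _, .sym x y => OpenHypergraph.symW [x] [y]
  | _, _, .null => OpenHypergraph.idW []
  | _, _, .comp s t => s.interp.comp t.interp
  | _, _, .par s t => s.interp.par t.interp

/-! ### Open hypergraphs up to isomorphism -/

/-- Open hypergraphs from `a` to `b`, up to isomorphism. -/
def Hyp (S : Signature.{u, v}) (a b : List S.Obj) : Type (max 1 u v) :=
  Quotient (OpenHypergraph.setoid (S := S) a b)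

namespace Hyp

variable {S : Signature.{u, v}}

/-- The isomorphism class of an open hypergraph. -/
def mk {a b : List S.Obj} (G : OpenHypergraph S a b) : Hyp S a b := Quotient.mk _ G

/-- Sequential composition of isomorphism classes. -/
def comp {a b c : List S.Obj} (f : Hyp S a b) (g : Hyp S b c) : Hyp S a c :=
  Quotient.map₂ OpenHypergraph.comp (by rintro _ _ ⟨i⟩ _ _ ⟨j⟩; exact ⟨i.comp j⟩) f g

/-- Parallel composition of isomorphism classes. -/
def par {a b a' b' : List S.Obj} (f : Hyp S a b) (g : Hyp S a' b') :
    Hyp S (a ++ a') (b ++ b') :=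
  Quotient.map₂ OpenHypergraph.par (by rintro _ _ ⟨i⟩ _ _ ⟨j⟩; exact ⟨i.par j⟩) f g

/-- The members of the isomorphism class are monogamous. -/
def Monogamous {a b : List S.Obj} (f : Hyp S a b) : Prop :=
  Quotient.lift OpenHypergraph.Monogamous
    (by rintro _ _ ⟨i⟩; exact propext ⟨i.monogamous, i.symm.monogamous⟩) f

/-- The members of the isomorphism class are acyclic. -/
def Acyclic {a b : List S.Obj} (f : Hyp S a b) : Prop :=
  Quotient.lift OpenHypergraph.Acyclic
    (by rintro _ _ ⟨i⟩; exact propext ⟨i.acyclic, i.symm.acyclic⟩) f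

end Hyp

/-- Monogamous acyclic open hypergraphs from `a` to `b`, up to isomorphism. -/
def MonHyp (S : Signature.{u, v}) (a b : List S.Obj) : Type (max 1 u v) :=
  {f : Hyp S a b // f.Monogamous ∧ f.Acyclic}

end StrDiag

/-! Everything is compared inside one fixed hypergraph `K`. `K.Occurs t E N L M` says that the term
`t` describes the part of `K` with hyperedges `E`, nodes `N` and interfaces `L`, `M`. Each law of
symmetric monoidal categories preserves this relation (`Occurs.iff_of_eqv`), and `t` describes the
whole of `G` exactly when `t.interp` is isomorphic to `G` (`Term.nonempty_iso_iff`). Together these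
show that the interpretation is well defined on string diagrams, without isomorphisms between
iterated pushouts.

For faithfulness, diagrams are read off from runs (`Exec`): starting from wires for a list of nodes,
hyperedges are performed one by one, the wires being permuted before each of them so that its
sources come first. A part described by `t` has a run whose result is the diagram of `t`
(`Occurs.exists_exec`). As long as no node is listed twice among the initial nodes and the targets,
the result depends only on the two end lists and on the collection of hyperedges, not on their order
(`Exec.unique`). Two facts are behind this: wirings between the same lists of distinct nodes are
equal (`Wiring.unique`, coherence for symmetries), and consecutive hyperedges can be exchanged if
the first does not feed the second (`Exec.swap`). If `s.interp` and `t.interp` are isomorphic, then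
both diagrams are results of runs through all hyperedges of `t.interp`, hence they are equal.

For the image, monogamy says that the left interface followed by all targets lists every node
exactly once, and so does the right interface followed by all sources (`monogamous_iff`). Acyclicity
then provides an order in which all hyperedges can be performed (`Acyclic.exists_exec`), and the
resulting run is the diagram of a term describing the whole hypergraph (`Exec.exists_occurs`).
Conversely, a run through everything forces both properties.

So the interpretation is bijective onto `MonHyp`, and the categorical structure is transported along
it; it remains to recognise the transported operations as those of open hypergraphs. -/

namespace StrDiag

/-! ### Bundled string diagrams and their calculus -/

/-- A string diagram together with its type. -/
structure Arrow (S : Signature.{u, v}) where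
  /-- left interface -/
  dom : List S.Obj
  /-- right interface -/
  cod : List S.Obj
  /-- the diagram -/
  hom : Diagram S dom cod

variable {S : Signature.{u, v}}

namespace Arrow

/-- Bundling the type turns heterogeneous equalities into plain ones, so that associativity and unit
laws can be used for rewriting without casts. -/
theorem mk_eq_mk {a b a' b' : List S.Obj} {f : Diagram S a b} {f' : Diagram S a' b'}
    (ha : a = a') (hb : b = b') (hf : HEq f f') : Arrow.mk a b f = Arrow.mk a' b' f' := by
  subst ha hb; cases hf; rfl

theorem hom_injective {a b : List S.Obj} {f g : Diagram S a b}
    (h : Arrow.mk a b f = Arrow.mk a b g) : f = g := by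
  cases h; rfl

theorem mk_castHom {a a' b b' : List S.Obj} (ha : a = a') (hb : b = b') (f : Diagram S a b) :
    Arrow.mk a' b' (castHom ha hb f) = ⟨a, b, f⟩ := by
  subst ha hb; rfl

/-- The arrow of a term. -/
def of {a b : List S.Obj} (t : Term S a b) : Arrow S := ⟨a, b, Diagram.mk t⟩

theorem of_castHom {a a' b b' : List S.Obj} (ha : a = a') (hb : b = b') (t : Term S a b) :
    of (castHom ha hb t) = of t := by
  subst ha hb; rfl

/-- The identity arrow. -/
def wires (a : List S.Obj) : Arrow S := ⟨a, a, Diagram.idW a⟩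

/-- The symmetry arrow. -/
def cross (a b : List S.Obj) : Arrow S := ⟨a ++ b, b ++ a, Diagram.symW a b⟩

/-- Arrows form a monoid under parallel composition. -/
instance : Monoid (Arrow S) where
  mul f g := ⟨f.dom ++ g.dom, f.cod ++ g.cod, f.hom.par g.hom⟩
  one := wires []
  mul_assoc f g h := mk_eq_mk (List.append_assoc _ _ _) (List.append_assoc _ _ _)
    (Diagram.par_assoc_heq _ _ _)
  one_mul f := mk_eq_mk rfl rfl (heq_of_eq (Diagram.null_par _))
  mul_one f := mk_eq_mk (List.append_nil _) (List.append_nil _)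
    ((Diagram.castHom_heq _ _ _).symm.trans (heq_of_eq (Diagram.par_null _)))

open Classical in
/-- Sequential composition of arrows; when the interfaces do not match, the first arrow. -/
noncomputable def comp (f g : Arrow S) : Arrow S :=
  if h : f.cod = g.dom then ⟨f.dom, g.cod, f.hom.comp (castHom h.symm rfl g.hom)⟩ else f

scoped infixr:60 " ⨾ " => Arrow.comp

theorem mk_comp_mk {a b c : List S.Obj} (f : Diagram S a b) (g : Diagram S b c) :
    (⟨a, b, f⟩ : Arrow S) ⨾ ⟨b, c, g⟩ = ⟨a, c, f.comp g⟩ := by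
  simp [comp, castHom]

theorem mk_mul_mk {a b c d : List S.Obj} (f : Diagram S a b) (g : Diagram S c d) :
    (⟨a, b, f⟩ : Arrow S) * ⟨c, d, g⟩ = ⟨a ++ c, b ++ d, f.par g⟩ := rfl

theorem of_comp {a b c : List S.Obj} (s : Term S a b) (t : Term S b c) :
    of (s.comp t) = of s ⨾ of t :=
  (mk_comp_mk (Diagram.mk s) (Diagram.mk t)).symm

theorem of_par {a b c d : List S.Obj} (s : Term S a b) (t : Term S c d) :
    of (s.par t) = of s * of t := rfl

theorem wires_nil : wires ([] : List S.Obj) = 1 := rfl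

@[simp] theorem dom_wires (a : List S.Obj) : (wires a).dom = a := (rfl)
@[simp] theorem cod_wires (a : List S.Obj) : (wires a).cod = a := (rfl)
@[simp] theorem dom_cross (a b : List S.Obj) : (cross a b).dom = a ++ b := (rfl)
@[simp] theorem cod_cross (a b : List S.Obj) : (cross a b).cod = b ++ a := (rfl)
@[simp] theorem dom_of {a b : List S.Obj} (t : Term S a b) : (of t).dom = a := (rfl)
@[simp] theorem cod_of {a b : List S.Obj} (t : Term S a b) : (of t).cod = b := (rfl)
@[simp] theorem dom_mul (f g : Arrow S) : (f * g).dom = f.dom ++ g.dom := (rfl)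
@[simp] theorem cod_mul (f g : Arrow S) : (f * g).cod = f.cod ++ g.cod := (rfl)
@[simp] theorem dom_one : (1 : Arrow S).dom = [] := (rfl)
@[simp] theorem cod_one : (1 : Arrow S).cod = [] := (rfl)

-- The default value `f` of a mismatched composite also has domain `f.dom`, so no matching condition
-- is needed.
@[simp] theorem dom_comp (f g : Arrow S) : (f ⨾ g).dom = f.dom := by
  unfold comp; split <;> rfl

@[simp] theorem cod_comp {f g : Arrow S} (h : f.cod = g.dom) : (f ⨾ g).cod = g.cod := by
  simp [comp, h]

theorem comp_assoc {f g h : Arrow S} (hfg : f.cod = g.dom) (hgh : g.cod = h.dom) :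
    (f ⨾ g) ⨾ h = f ⨾ g ⨾ h := by
  obtain ⟨a, b, f⟩ := f
  obtain ⟨_, c, g⟩ := g
  obtain ⟨_, d, h⟩ := h
  cases hfg; cases hgh
  simp only [mk_comp_mk, Diagram.assoc]

theorem wires_comp {a : List S.Obj} {f : Arrow S} (h : f.dom = a) : wires a ⨾ f = f := by
  subst h
  obtain ⟨a, b, f⟩ := f
  exact (mk_comp_mk _ _).trans (by rw [Diagram.id_comp])

theorem comp_wires {a : List S.Obj} {f : Arrow S} (h : f.cod = a) : f ⨾ wires a = f := by
  subst h
  obtain ⟨a, b, f⟩ := f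
  exact (mk_comp_mk _ _).trans (by rw [Diagram.comp_id])

theorem wires_mul_wires (a b : List S.Obj) : wires a * wires b = wires (a ++ b) :=
  congrArg (Arrow.mk _ _) (Diagram.par_id a b)

theorem mul_comp_mul {f g f' g' : Arrow S} (h : f.cod = g.dom) (h' : f'.cod = g'.dom) :
    (f * f') ⨾ (g * g') = (f ⨾ g) * (f' ⨾ g') := by
  obtain ⟨a, b, f⟩ := f
  obtain ⟨_, c, g⟩ := g
  obtain ⟨a', b', f'⟩ := f'
  obtain ⟨_, c', g'⟩ := g'
  cases h; cases h'
  simp only [mk_comp_mk, mk_mul_mk, Diagram.interchange]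

theorem wires_mul_comp {a : List S.Obj} {f g : Arrow S} (h : f.cod = g.dom) :
    wires a * (f ⨾ g) = (wires a * f) ⨾ (wires a * g) := by
  rw [mul_comp_mul rfl h, wires_comp (dom_wires a)]

theorem comp_mul_wires {a : List S.Obj} {f g : Arrow S} (h : f.cod = g.dom) :
    (f ⨾ g) * wires a = (f * wires a) ⨾ (g * wires a) := by
  rw [mul_comp_mul h rfl, wires_comp (dom_wires a)]

/-- Two arrows side by side can be performed one after the other. -/
theorem mul_wires_comp_wires_mul {a b : List S.Obj} {f g : Arrow S} (hf : f.cod = b) (hg : g.dom = a) :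
    (f * wires a) ⨾ (wires b * g) = f * g := by
  rw [mul_comp_mul hf hg.symm, comp_wires hf, wires_comp hg]

theorem wires_mul_comp_mul_wires {a b : List S.Obj} {f g : Arrow S} (hf : f.dom = a) (hg : g.cod = b) :
    (wires a * g) ⨾ (f * wires b) = f * g := by
  rw [mul_comp_mul hf.symm hg, comp_wires hg, wires_comp hf]

theorem cross_natural {a b c : List S.Obj} {f : Arrow S} (hb : f.dom = b) (hc : f.cod = c) :
    (wires a * f) ⨾ cross a c = cross a b ⨾ (f * wires a) := by
  subst hb hc
  obtain ⟨b, c, f⟩ := f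
  simp only [wires, cross, mk_comp_mk, mk_mul_mk, Diagram.sym_natural]

theorem cross_comp_cross (a b : List S.Obj) : cross a b ⨾ cross b a = wires (a ++ b) := by
  rw [← wires_mul_wires]
  simp only [wires, cross, mk_comp_mk, mk_mul_mk, Diagram.sym_iso]

/-- Naturality in the other argument: conjugate `cross_natural` by the crossings, which are mutually
inverse. -/
theorem cross_natural' {a b c : List S.Obj} {f : Arrow S} (hb : f.dom = b) (hc : f.cod = c) :
    (f * wires a) ⨾ cross c a = cross b a ⨾ (wires a * f) := by
  have h := cross_natural (a := a) hb hc
  calc (f * wires a) ⨾ cross c a = (cross b a ⨾ cross a b) ⨾ (f * wires a) ⨾ cross c a := by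
        rw [cross_comp_cross, wires_comp (by simp [hb])]
    _ = cross b a ⨾ (cross a b ⨾ (f * wires a)) ⨾ cross c a := by
        rw [comp_assoc (by simp) (by simp [hb]), comp_assoc (by simp [hb]) (by simp [hc])]
    _ = cross b a ⨾ (wires a * f) := by
        rw [← h, comp_assoc (by simp [hc]) (by simp), cross_comp_cross, comp_wires (by simp [hc])]

theorem cross_nil_left (b : List S.Obj) : cross [] b = wires b :=
  of_castHom rfl (List.append_nil b).symm (Term.idW b)

theorem cross_append_left (a b c : List S.Obj) :
    cross (a ++ b) c = (wires a * cross b c) ⨾ (cross a c * wires b) := by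
  have h : (wires a * cross b c) ⨾ (cross a c * wires b) = ⟨a ++ (b ++ c), c ++ a ++ b,
      Diagram.comp (Diagram.par (Diagram.idW a) (Diagram.symW b c))
        (castHom (List.append_assoc a c b) rfl
          (Diagram.par (Diagram.symW a c) (Diagram.idW b)))⟩ := by
    rw [← mk_comp_mk, mk_castHom]; rfl
  rw [h]
  exact mk_eq_mk (List.append_assoc _ _ _) (List.append_assoc _ _ _).symm
    (Diagram.symW_append_heq a b c)

/-- `idW [x]` unfolds to `Term.id x` beside `null`, so this is the right unit law. -/
theorem of_id (x : S.Obj) : of (Term.id x) = wires [x] := (mul_one (of (Term.id x))).symm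

theorem of_symX_singleton (x y : S.Obj) : of (Term.symX x [y]) = of (Term.sym x y) := by
  have h : of (Term.symX x [y]) = (of (Term.sym x y) * 1) ⨾ (of (Term.id y) * of (Term.id x)) :=
    of_comp _ _
  rw [h, mul_one, of_id, of_id, wires_mul_wires]
  exact comp_wires rfl

/-- Links the generator `sym` to the recursively defined `symW`: all other factors in the unfolding
of `symW [x] [y]` are identities. -/
theorem cross_singleton (x y : S.Obj) : cross [x] [y] = of (Term.sym x y) := by
  have h : cross [x] [y] = of (Term.comp
      (Term.par (a := [x]) (b := [x]) (Term.id x) (Term.symW [] [y]))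
        (Term.par (a := [x, y]) (b := [y, x]) (Term.symX x [y]) (Term.idW []))) :=
    of_castHom _ _ _
  rw [h, of_comp, of_par, of_par, of_symX_singleton, of_id]
  have h1 : of (Term.symW [] [y] : Term S _ _) = wires [y] := cross_nil_left [y]
  have h2 : of (Term.idW [] : Term S _ _) = 1 := rfl
  rw [h1, h2, mul_one, wires_mul_wires]
  exact wires_comp rfl

/-- By `cross_append_left`, the right-hand side followed by `cross (b ++ c) a` is an identity; since
`cross a (b ++ c)` is the inverse of that crossing, the two agree. -/
theorem cross_append_right (a b c : List S.Obj) :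
    cross a (b ++ c) = (cross a b * wires c) ⨾ (wires b * cross a c) := by
  have h : ((cross a b * wires c) ⨾ (wires b * cross a c)) ⨾ cross (b ++ c) a = wires (a ++ (b ++ c)) := by
    rw [cross_append_left, comp_assoc (by simp) (by simp),
      ← comp_assoc (f := wires b * cross a c) (by simp) (by simp), ← wires_mul_comp (by simp),
      cross_comp_cross, wires_mul_wires, wires_comp (by simp), ← comp_mul_wires (by simp), cross_comp_cross,
      wires_mul_wires, List.append_assoc]
  rw [← comp_wires (f := (cross a b * wires c) ⨾ (wires b * cross a c)) (a := (b ++ c) ++ a) (by simp),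
    ← cross_comp_cross (b ++ c) a, ← comp_assoc (by simp) (by simp), h, wires_comp (by simp)]

/-- Two bundles can be crossed before or after a third one is moved in front of them. -/
theorem cross_mul_comp_pull (a b c w : List S.Obj) {P : Arrow S} (hP : P.cod = c ++ w) :
    (cross a b * wires P.dom) ⨾ (wires b * ((wires a * P) ⨾ (cross a c * wires w))) ⨾
        (cross b c * wires (a ++ w)) =
      ((wires a * ((wires b * P) ⨾ (cross b c * wires w))) ⨾ (cross a c * wires (b ++ w))) ⨾
        (wires c * (cross a b * wires w)) := by
  -- Naturality of the crossing with `c` applied to `cross a b` itself: the Yang–Baxter relation.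
  -- `hl` and `hr` bring the two sides into a form to which it applies.
  have h := cross_natural' (a := c) (dom_cross a b) (cod_cross a b)
  have hl : (wires b * ((wires a * P) ⨾ (cross a c * wires w))) ⨾ (cross b c * wires (a ++ w)) =
      (wires (b ++ a) * P) ⨾ (cross (b ++ a) c * wires w) := by
    rw [wires_mul_comp (by simp [hP]), comp_assoc (by simp [hP]) (by simp), cross_append_left,
      comp_mul_wires (by simp), ← wires_mul_wires a w, ← wires_mul_wires b a]
    simp only [mul_assoc]
  have hr : (wires a * ((wires b * P) ⨾ (cross b c * wires w))) ⨾ (cross a c * wires (b ++ w)) =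
      (wires (a ++ b) * P) ⨾ (cross (a ++ b) c * wires w) := by
    rw [wires_mul_comp (by simp [hP]), comp_assoc (by simp [hP]) (by simp), cross_append_left,
      comp_mul_wires (by simp), ← wires_mul_wires b w, ← wires_mul_wires a b]
    simp only [mul_assoc]
  rw [hl, hr, ← comp_assoc (by simp) (by simp [hP]), mul_wires_comp_wires_mul (by simp) rfl,
    ← wires_mul_comp_mul_wires (a := a ++ b) (f := cross a b) (g := P) (by simp) hP,
    comp_assoc (by simp [hP]) (by simp), comp_assoc (by simp [hP]) (by simp), ← mul_assoc,
    ← comp_mul_wires (by simp), ← h, comp_mul_wires (by simp), ← wires_mul_wires c w, mul_assoc]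

end Arrow

open Arrow

/-! ### Permutations of wires and coherence for symmetries -/

section wiring

variable {N : Type w} {l : N → S.Obj}

/-- The arrow `D`, from the labels of the list `L` to those of the list `M`, is a composite of
crossings that permutes `L` to `M`. -/
inductive Wiring (l : N → S.Obj) : List N → List N → Arrow S → Prop
  | nil : Wiring l [] [] 1
  | cons (x : N) {L M : List N} {D : Arrow S} :
      Wiring l L M D → Wiring l (x :: L) (x :: M) (wires [l x] * D)
  | swap (x y : N) (L : List N) :
      Wiring l (y :: x :: L) (x :: y :: L) (cross [l y] [l x] * wires (L.map l))
  | trans {L M R : List N} {D E : Arrow S} :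
      Wiring l L M D → Wiring l M R E → Wiring l L R (D ⨾ E)

namespace Wiring

theorem dom_cod {L M : List N} {D : Arrow S} (h : Wiring l L M D) :
    D.dom = L.map l ∧ D.cod = M.map l := by
  induction h with
  | nil => simp
  | cons x _ ih => simp [ih]
  | swap x y L => simp
  | trans _ _ ih₁ ih₂ => simp [ih₁, ih₂]

theorem dom_eq {L M : List N} {D : Arrow S} (h : Wiring l L M D) : D.dom = L.map l :=
  h.dom_cod.1

theorem cod_eq {L M : List N} {D : Arrow S} (h : Wiring l L M D) : D.cod = M.map l :=
  h.dom_cod.2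

theorem perm {L M : List N} {D : Arrow S} (h : Wiring l L M D) : L.Perm M := by
  induction h with
  | nil => exact .nil
  | cons x _ ih => exact ih.cons x
  | swap x y L => exact .swap x y L
  | trans _ _ ih₁ ih₂ => exact ih₁.trans ih₂

variable (l) in
-- The constructors of `Wiring` mirror those of `List.Perm`.
theorem exists_of_perm {L M : List N} (h : L.Perm M) : ∃ D, Wiring l L M D := by
  induction h with
  | nil => exact ⟨_, nil⟩
  | cons x _ ih => exact ih.elim fun _ h => ⟨_, cons x h⟩
  | swap x y L => exact ⟨_, swap x y L⟩
  | trans _ _ ih₁ ih₂ => exact ih₁.elim fun _ h₁ => ih₂.elim fun _ h₂ => ⟨_, trans h₁ h₂⟩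

variable (l) in
theorem refl (L : List N) : Wiring l L L (wires (L.map l)) := by
  induction L with
  | nil => exact nil
  | cons x L ih =>
    have h := cons x ih
    rwa [wires_mul_wires] at h

theorem append_right {L M : List N} {D : Arrow S} (h : Wiring l L M D) (A : List N) :
    Wiring l (L ++ A) (M ++ A) (D * wires (A.map l)) := by
  induction h with
  | nil => simpa using refl l A
  | cons x _ ih => rw [mul_assoc]; exact cons x ih
  | swap x y L =>
    rw [mul_assoc, wires_mul_wires, ← List.map_append]
    exact swap x y (L ++ A)
  | trans h₁ h₂ ih₁ ih₂ =>
    rw [comp_mul_wires (h₁.cod_eq.trans h₂.dom_eq.symm)]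
    exact trans ih₁ ih₂

theorem append_left {L M : List N} {D : Arrow S} (h : Wiring l L M D) (A : List N) :
    Wiring l (A ++ L) (A ++ M) (wires (A.map l) * D) := by
  induction A with
  | nil => simpa [wires_nil] using h
  | cons x A ih =>
    have h' := cons x ih
    rwa [← mul_assoc, wires_mul_wires] at h'

variable (l) in
theorem crossing_singleton (A : List N) (y : N) :
    Wiring l (A ++ [y]) (y :: A) (cross (A.map l) [l y]) := by
  induction A with
  | nil =>
    rw [List.map_nil, cross_nil_left]
    exact refl l [y]
  | cons x A ih =>
    have h := trans (cons x ih) (swap y x A)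
    rwa [← cross_append_left [l x] (A.map l) [l y]] at h

variable (l) in
theorem crossing (A B : List N) : Wiring l (A ++ B) (B ++ A) (cross (A.map l) (B.map l)) := by
  induction B with
  | nil =>
    have h : cross (A.map l) [] = wires (A.map l) := by
      have h := cross_comp_cross (A.map l) []
      rw [cross_nil_left, comp_wires (by simp)] at h
      simpa using h
    simpa [h] using refl l A
  | cons y B ih =>
    have h := trans ((crossing_singleton l A y).append_right B) (cons y ih)
    rw [← cross_append_right (A.map l) [l y] (B.map l)] at h
    simpa using h

section

variable [DecidableEq N]

variable (l) in
/-- The arrow that moves the node `z` to the front. -/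
noncomputable def pull (z : N) : List N → Arrow S
  -- Default value: `pull l z L` moves `z` to the front only if `z ∈ L`.
  | [] => 1
  | y :: L => if y = z then wires (l y :: L.map l) else
      (wires [l y] * pull z L) ⨾ (cross [l y] [l z] * wires ((L.erase z).map l))

theorem pull_cons_self (z : N) (L : List N) : pull l z (z :: L) = wires (l z :: L.map l) := by
  simp [pull]

theorem pull_cons_of_ne {y z : N} (h : y ≠ z) (L : List N) : pull l z (y :: L) =
      (wires [l y] * pull l z L) ⨾ (cross [l y] [l z] * wires ((L.erase z).map l)) := by
  simp [pull, h]

theorem dom_pull (z : N) (L : List N) : (pull l z L).dom = L.map l := by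
  induction L with
  | nil => rfl
  | cons y L ih => rw [pull]; split <;> simp [ih]

theorem cod_pull {z : N} {L : List N} (h : z ∈ L) :
    (pull l z L).cod = l z :: (L.erase z).map l := by
  induction L with
  | nil => simp at h
  | cons y L ih =>
    by_cases hy : y = z
    · subst hy; simp [pull_cons_self]
    · have hz : z ∈ L := by simpa [Ne.symm hy] using h
      simp [pull_cons_of_ne hy, ih hz, hy]

/-- The induction step for `unique`: pulling `z` forward after a wiring is the same as pulling it
forward first and then wiring the other nodes. Distinctness matters because `pull` stops at the
first occurrence of `z`. -/
theorem comp_pull {L M : List N} {D : Arrow S} (h : Wiring l L M D) {z : N} (hz : z ∈ L)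
    (hL : L.Nodup) : ∃ D', Wiring l (L.erase z) (M.erase z) D' ∧
      D ⨾ pull l z M = pull l z L ⨾ (wires [l z] * D') := by
  induction h with
  | nil => simp at hz
  | @cons x L M D h ih =>
    by_cases hx : x = z
    · subst hx
      refine ⟨D, by simpa using h, ?_⟩
      rw [pull_cons_self, pull_cons_self, wires_comp (by simp [h.dom_eq]),
        comp_wires (by simp [h.cod_eq])]
    · have hzL : z ∈ L := by simpa [Ne.symm hx] using hz
      have hzM : z ∈ M := h.perm.subset hzL
      obtain ⟨E, hE, he⟩ := ih hzL (List.nodup_cons.1 hL).2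
      refine ⟨wires [l x] * E, by simpa [hx] using cons x hE, ?_⟩
      have hd := hE.dom_eq
      have hc := hE.cod_eq
      have hp := cod_pull (l := l) hzL
      have hq := cod_pull (l := l) hzM
      rw [pull_cons_of_ne hx, pull_cons_of_ne hx,
        ← comp_assoc (by simp [h.cod_eq, dom_pull]) (by simp [hq]),
        ← wires_mul_comp (by simp [h.cod_eq, dom_pull]), he, wires_mul_comp (by simp [hp, hd]),
        comp_assoc (by simp [hp, hd]) (by simp [hc]), comp_assoc (by simp [hp]) (by simp [hd])]
      congr 1
      rw [← mul_assoc, ← mul_assoc, wires_mul_wires, wires_mul_wires, wires_mul_comp_mul_wires (by simp) hc,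
        mul_wires_comp_wires_mul (by simp) hd]
  | swap x y L =>
    have hxy : y ≠ x := by
      rintro rfl
      simp at hL
    -- If `z` is one of the two crossed wires, the crossing either cancels against the one in `pull`
    -- or coincides with it, and the remaining wiring is an identity.
    by_cases hy : y = z
    · subst hy
      refine ⟨wires ((x :: L).map l), ?_, ?_⟩
      · simpa [Ne.symm hxy] using refl l (x :: L)
      · rw [pull_cons_of_ne (Ne.symm hxy), pull_cons_self, pull_cons_self, List.erase_cons_head,
          wires_mul_wires, wires_mul_wires, wires_comp (by simp), wires_comp (by simp),
          mul_comp_mul (by simp) (by simp), cross_comp_cross, wires_comp (by simp), wires_mul_wires]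
        simp
    by_cases hx : x = z
    · subst hx
      refine ⟨wires ((y :: L).map l), ?_, ?_⟩
      · simpa [hxy] using refl l (y :: L)
      · rw [pull_cons_of_ne hxy, pull_cons_self, pull_cons_self, List.erase_cons_head,
          wires_mul_wires, wires_mul_wires, wires_comp (by simp), comp_wires (by simp),
          comp_wires (by simp)]
    -- Now three different wires are involved, and the Yang–Baxter relation in the form
    -- `cross_mul_comp_pull` is needed.
    have hzL : z ∈ L := by simpa [Ne.symm hx, Ne.symm hy] using hz
    refine ⟨_, by simpa [hx, hy] using swap x y (L.erase z), ?_⟩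
    rw [pull_cons_of_ne hx, pull_cons_of_ne hy, pull_cons_of_ne hy, pull_cons_of_ne hx]
    have h := cross_mul_comp_pull [l y] [l x] [l z] ((L.erase z).map l) (P := pull l z L)
      (cod_pull hzL)
    simpa [hx, hy, dom_pull] using h
  | trans h₁ h₂ ih₁ ih₂ =>
    obtain ⟨D₁, hD₁, e₁⟩ := ih₁ hz hL
    obtain ⟨D₂, hD₂, e₂⟩ := ih₂ (h₁.perm.subset hz) (h₁.perm.nodup_iff.1 hL)
    refine ⟨_, trans hD₁ hD₂, ?_⟩
    have hp := cod_pull (l := l) hz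
    have hq := cod_pull (l := l) (h₁.perm.subset hz)
    rw [comp_assoc (by simp [h₁.cod_eq, h₂.dom_eq]) (by simp [dom_pull, h₂.cod_eq]), e₂,
      ← comp_assoc (by simp [h₁.cod_eq, dom_pull]) (by simp [hq, hD₂.dom_eq]), e₁,
      comp_assoc (by simp [hp, hD₁.dom_eq]) (by simp [hD₁.cod_eq, hD₂.dom_eq]),
      wires_mul_comp (by simp [hD₁.cod_eq, hD₂.dom_eq])]

/-- Induction on the target list: pulling its head `z` forward in the target does nothing, so
`comp_pull` writes both arrows as `pull l z L` followed by a wiring of the other nodes. -/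
theorem unique {L M : List N} {D E : Arrow S} (hD : Wiring l L M D) (hE : Wiring l L M E)
    (hL : L.Nodup) : D = E := by
  induction M generalizing L D E with
  | nil =>
    -- The target is kept variable because `trans` passes through an intermediate list.
    have key : ∀ {L M : List N} {D : Arrow S}, Wiring l L M D → M = [] → D = 1 := by
      intro L M D h hM
      induction h with
      | nil => rfl
      | cons => simp at hM
      | swap => simp at hM
      | trans h₁ h₂ ih₁ ih₂ =>
        subst hM
        rw [ih₁ h₂.perm.eq_nil, ih₂ rfl]
        exact wires_comp (a := []) rfl
    rw [key hD rfl, key hE rfl]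
  | cons z M ih =>
    have hz : z ∈ L := hD.perm.symm.subset List.mem_cons_self
    obtain ⟨D', hD', eD⟩ := hD.comp_pull hz hL
    obtain ⟨E', hE', eE⟩ := hE.comp_pull hz hL
    rw [pull_cons_self, comp_wires (by simp [hD.cod_eq])] at eD
    rw [pull_cons_self, comp_wires (by simp [hE.cod_eq])] at eE
    rw [List.erase_cons_head] at hD' hE'
    rw [eD, eE, ih hD' hE' (hL.erase z)]

end

end Wiring

end wiring

/-! ### Runs: performing hyperedges one after the other -/

/-- Two independent arrows in either order: by naturality both sides reduce to `cross a c ⨾ (g * f)`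
beside the wires for `w`. This is the algebra behind `Exec.swap`. -/
theorem Arrow.exchange {a b c d : List S.Obj} (w : List S.Obj) {f g : Arrow S}
    (ha : f.dom = a) (hb : f.cod = b) (hc : g.dom = c) (hd : g.cod = d) :
    (f * wires (c ++ w)) ⨾ (cross b c * wires w) ⨾ (g * wires (b ++ w)) =
      (cross a c * wires w) ⨾ (g * wires (a ++ w)) ⨾ (cross d a * wires w) ⨾
        (f * wires (d ++ w)) ⨾ (cross b d * wires w) := by
  have hl : (f * wires c) ⨾ cross b c ⨾ (g * wires b) = cross a c ⨾ (g * f) := by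
    rw [← comp_assoc (by simp [hb]) (by simp [hc]), cross_natural' ha hb,
      comp_assoc (by simp [ha]) (by simp [hb, hc]), wires_mul_comp_mul_wires hc hb]
  have hr : cross a c ⨾ (g * wires a) ⨾ cross d a ⨾ (f * wires d) ⨾ cross b d =
      cross a c ⨾ (g * f) := by
    rw [cross_natural' ha hb, ← comp_assoc (f := cross d a) (by simp) (by simp [ha]),
      cross_comp_cross, wires_comp (by simp [ha]), mul_wires_comp_wires_mul hd ha]
  simp only [← wires_mul_wires, ← mul_assoc]
  rw [← comp_mul_wires (by simp [hc]), ← comp_mul_wires (by simp [hb]),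
    ← comp_mul_wires (by simp [hb]), ← comp_mul_wires (by simp [ha]),
    ← comp_mul_wires (by simp [hd]), ← comp_mul_wires (by simp [hc]), hl, hr]

theorem exists_perm_append_of_subset {α : Type*} {l₁ l₂ : List α} (h : l₁.Nodup)
    (h' : l₁ ⊆ l₂) : ∃ l, l₂.Perm (l₁ ++ l) := by
  obtain ⟨l, h₁, h₂⟩ := List.subperm_of_subset h h'
  obtain ⟨l', h₃⟩ := h₂.exists_perm_append
  exact ⟨l', h₃.trans (h₁.append_right l')⟩

namespace Hypergraph

variable (K : Hypergraph S)

/-- The arrow of a hyperedge next to wires for the nodes of a list. -/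
def step (e : K.Edge) (R : List K.Node) : Arrow S :=
  of (Term.op (K.edgeLabel e)) * wires (R.map K.nodeLabel)

theorem dom_step (e : K.Edge) (R : List K.Node) :
    (K.step e R).dom = (K.src e ++ R).map K.nodeLabel := by
  simp [step, K.src_label]

theorem cod_step (e : K.Edge) (R : List K.Node) :
    (K.step e R).cod = (K.tgt e ++ R).map K.nodeLabel := by
  simp [step, K.tgt_label]

/-- The arrow `D` is obtained by starting with wires for the nodes in `L`, performing the
hyperedges in `es` in this order, each one replacing its sources by its targets, and arriving at
the nodes in `M`. -/
inductive Exec : List K.Node → List K.Edge → List K.Node → Arrow S → Prop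
  | nil {L M : List K.Node} {D : Arrow S} : Wiring K.nodeLabel L M D → Exec L [] M D
  | cons {L R M : List K.Node} {e : K.Edge} {es : List K.Edge} {P D : Arrow S} :
      Wiring K.nodeLabel L (K.src e ++ R) P → Exec (K.tgt e ++ R) es M D →
      Exec L (e :: es) M (P ⨾ K.step e R ⨾ D)

namespace Exec

variable {K}

theorem dom_cod {L M : List K.Node} {es : List K.Edge} {D : Arrow S} (h : K.Exec L es M D) :
    D.dom = L.map K.nodeLabel ∧ D.cod = M.map K.nodeLabel := by
  induction h with
  | nil h => exact h.dom_cod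
  | cons h _ ih =>
    refine ⟨by simp [h.dom_eq], ?_⟩
    rw [cod_comp (by simp [h.cod_eq, dom_step]), cod_comp (by simp [cod_step, ih.1]), ih.2]

theorem dom_eq {L M : List K.Node} {es : List K.Edge} {D : Arrow S} (h : K.Exec L es M D) :
    D.dom = L.map K.nodeLabel := h.dom_cod.1

theorem cod_eq {L M : List K.Node} {es : List K.Edge} {D : Arrow S} (h : K.Exec L es M D) :
    D.cod = M.map K.nodeLabel := h.dom_cod.2

theorem wiring_comp {L M R : List K.Node} {es : List K.Edge} {P D : Arrow S}
    (hP : Wiring K.nodeLabel L M P) (h : K.Exec M es R D) : K.Exec L es R (P ⨾ D) := by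
  cases h with
  | nil h => exact nil (hP.trans h)
  | cons h h' =>
    rw [← comp_assoc (by simp [hP.cod_eq, h.dom_eq]) (by simp [h.cod_eq, dom_step])]
    exact cons (hP.trans h) h'

theorem append {L M R : List K.Node} {es es' : List K.Edge} {D E : Arrow S}
    (h : K.Exec L es M D) (h' : K.Exec M es' R E) : K.Exec L (es ++ es') R (D ⨾ E) := by
  induction h with
  | nil h => exact wiring_comp h h'
  | cons h₁ h₂ ih =>
    rw [comp_assoc (by simp [h₁.cod_eq, dom_step]) (by simp [cod_step, h₂.dom_eq, h₂.cod_eq,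
      h'.dom_eq]), comp_assoc (by simp [cod_step, h₂.dom_eq]) (by simp [h₂.cod_eq, h'.dom_eq])]
    exact cons h₁ (ih h')

theorem comp_wiring {L M R : List K.Node} {es : List K.Edge} {P D : Arrow S}
    (h : K.Exec L es M D) (hP : Wiring K.nodeLabel M R P) : K.Exec L es R (D ⨾ P) := by
  simpa using h.append (nil hP)

theorem append_right {L M : List K.Node} {es : List K.Edge} {D : Arrow S}
    (h : K.Exec L es M D) (A : List K.Node) :
    K.Exec (L ++ A) es (M ++ A) (D * wires (A.map K.nodeLabel)) := by
  induction h with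
  | nil h => exact nil (h.append_right A)
  | @cons L R M e es P D h h' ih =>
    have h₁ := h.append_right A
    rw [List.append_assoc] at h₁ ih
    have h₂ := cons h₁ ih
    have hs : K.step e (R ++ A) = K.step e R * wires (A.map K.nodeLabel) := by
      simp [step, mul_assoc, wires_mul_wires]
    rwa [hs, ← comp_mul_wires (by simp [cod_step, h'.dom_eq]),
      ← comp_mul_wires (by simp [h.cod_eq, dom_step])] at h₂

/-- Conjugate `append_right` by crossings that carry `A` to the other side; naturality makes the two
crossings cancel. -/
theorem append_left {L M : List K.Node} {es : List K.Edge} {D : Arrow S}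
    (h : K.Exec L es M D) (A : List K.Node) :
    K.Exec (A ++ L) es (A ++ M) (wires (A.map K.nodeLabel) * D) := by
  have h' := wiring_comp (Wiring.crossing K.nodeLabel A L) ((h.append_right A).comp_wiring
    (Wiring.crossing K.nodeLabel M A))
  rwa [← comp_assoc (by simp [h.dom_eq]) (by simp [h.cod_eq]),
    ← cross_natural h.dom_eq h.cod_eq, comp_assoc (by simp [h.cod_eq]) (by simp),
    cross_comp_cross, comp_wires (by simp [h.cod_eq])] at h'

/-- Conservation of wires: what is given or produced is what is consumed or left over. -/
theorem perm {L M : List K.Node} {es : List K.Edge} {D : Arrow S} (h : K.Exec L es M D) :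
    (L ++ es.flatMap K.tgt).Perm (es.flatMap K.src ++ M) := by
  induction h with
  | nil h => simpa using h.perm
  | @cons L R M e es P D h h' ih =>
    simp only [List.flatMap_cons, List.append_assoc] at ih ⊢
    refine (h.perm.append_right _).trans ?_
    rw [List.append_assoc]
    refine (List.Perm.append_left _ ?_)
    rw [← List.append_assoc]
    refine (List.perm_append_comm.append_right _).trans ?_
    simpa using ih

theorem src_subset {L M : List K.Node} {e : K.Edge} {es : List K.Edge} {D : Arrow S}
    (h : K.Exec L (e :: es) M D) : K.src e ⊆ L := by
  cases h with
  | cons h _ => exact fun x hx => h.perm.symm.subset (List.mem_append_left _ hx)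

/-- The initial wiring and the list of bystanders in a run can be chosen at will: two choices of
bystanders differ by a wiring `Q`, which slides past the hyperedge into the rest of the run. -/
theorem cons_inv {L R M : List K.Node} {e : K.Edge} {es : List K.Edge} {P D : Arrow S}
    (h : K.Exec L (e :: es) M D) (hL : L.Nodup) (hP : Wiring K.nodeLabel L (K.src e ++ R) P) :
    ∃ E, K.Exec (K.tgt e ++ R) es M E ∧ D = P ⨾ K.step e R ⨾ E := by
  cases h with
  | @cons _ R' _ _ _ P' E h h' =>
    obtain ⟨Q, hQ⟩ := Wiring.exists_of_perm K.nodeLabel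
      ((List.perm_append_left_iff _).1 (hP.perm.symm.trans h.perm))
    have hP' : P' = P ⨾ (wires ((K.src e).map K.nodeLabel) * Q) := by
      classical exact h.unique (hP.trans (hQ.append_left _)) hL
    refine ⟨_, wiring_comp (hQ.append_left (K.tgt e)) h', ?_⟩
    have hs : (wires ((K.src e).map K.nodeLabel) * Q) ⨾ K.step e R' =
        K.step e R ⨾ (wires ((K.tgt e).map K.nodeLabel) * Q) := by
      rw [step, step, wires_mul_comp_mul_wires (by simp [K.src_label]) hQ.cod_eq,
        mul_wires_comp_wires_mul (by simp [K.tgt_label]) hQ.dom_eq]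
    rw [hP', comp_assoc (by simp [hP.cod_eq, hQ.dom_eq]) (by simp [dom_step, hQ.cod_eq]),
      ← comp_assoc (f := wires ((K.src e).map K.nodeLabel) * Q) (by simp [dom_step, hQ.cod_eq])
        (by simp [cod_step, h'.dom_eq]), hs,
      comp_assoc (by simp [cod_step, hQ.dom_eq]) (by simp [h'.dom_eq, hQ.cod_eq])]

/-- As `e` does not feed `e'`, the sources of both are present from the start. Both steps are
normalised by `cons_inv` to the order `K.src e`, `K.src e'`, bystanders, and then `Arrow.exchange`
applies. -/
theorem swap {L M : List K.Node} {e e' : K.Edge} {es : List K.Edge} {D : Arrow S}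
    (h : K.Exec L (e :: e' :: es) M D) (hL : (L ++ K.tgt e).Nodup)
    (he : (K.tgt e).Disjoint (K.src e')) : K.Exec L (e' :: e :: es) M D := by
  have hL' := (List.nodup_append'.1 hL).1
  obtain ⟨R₂, hR₂⟩ : ∃ R₂, L.Perm (K.src e ++ (K.src e' ++ R₂)) := by
    cases h with
    | @cons _ R _ _ _ _ _ h h' =>
      have hR : (K.tgt e ++ R).Nodup := by
        have h₁ : (K.src e ++ R ++ K.tgt e).Nodup := (h.perm.append_right _).nodup_iff.1 hL
        rw [List.append_assoc] at h₁
        exact (List.perm_append_comm.nodup_iff).1 (List.nodup_append'.1 h₁).2.1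
      cases h' with
      | cons h' _ =>
        have hn : (K.src e').Nodup :=
          (List.nodup_append'.1 (h'.perm.nodup_iff.1 hR)).1
        -- A source of `e'` that is not a target of `e` must be among the bystanders of `e`.
        have hs : K.src e' ⊆ R := fun x hx =>
          (List.mem_append.1 (h'.perm.symm.subset (List.mem_append_left _ hx))).resolve_left
            fun hx' => he hx' hx
        obtain ⟨R₂, hR₂⟩   := exists_perm_append_of_subset hn hs
        exact ⟨R₂, h.perm.trans (hR₂.append_left _)⟩
  obtain ⟨P, hP⟩ := Wiring.exists_of_perm K.nodeLabel hR₂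
  obtain ⟨D₁, hD₁, rfl⟩ := h.cons_inv hL' hP
  have w := fun A B => (Wiring.crossing K.nodeLabel A B).append_right R₂
  simp only [List.append_assoc] at w
  have hn : (K.tgt e ++ (K.src e' ++ R₂)).Nodup := by
    have h₁ : (K.src e ++ (K.src e' ++ R₂) ++ K.tgt e).Nodup :=
      (hR₂.append_right _).nodup_iff.1 hL
    rw [List.append_assoc] at h₁
    exact (List.perm_append_comm.nodup_iff).1 (List.nodup_append'.1 h₁).2.1
  obtain ⟨D₂, hD₂, rfl⟩ := hD₁.cons_inv hn (w (K.tgt e) (K.src e'))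
  have H := cons (hP.trans (w (K.src e) (K.src e'))) (cons (w (K.tgt e') (K.src e))
    (wiring_comp (w (K.tgt e) (K.tgt e')) hD₂))
  convert H using 1
  have hx := Arrow.exchange (R₂.map K.nodeLabel) (f := of (Term.op (K.edgeLabel e)))
    (g := of (Term.op (K.edgeLabel e'))) (by simpa using (K.src_label e).symm)
    (by simpa using (K.tgt_label e).symm) (by simpa using (K.src_label e').symm)
    (by simpa using (K.tgt_label e').symm)
  simp only [← List.map_append] at hx
  change K.step _ _ ⨾ _ ⨾ K.step _ _ = _ ⨾ K.step _ _ ⨾ _ ⨾ K.step _ _ ⨾ _ at hx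
  have hx' := congrArg (fun X => P ⨾ X ⨾ D₂) hx
  simp (disch := simp [hP.cod_eq, hD₂.dom_eq, dom_step, cod_step]) only [comp_assoc] at hx' ⊢
  exact hx'

/-- Carries the distinctness hypothesis to the next stage of a run, and also keeps the consumed
sources from reappearing there. -/
theorem nodup_of_perm {L R : List K.Node} {e : K.Edge} {es : List K.Edge}
    (hn : (L ++ (e :: es).flatMap K.tgt).Nodup) (h : L.Perm (K.src e ++ R)) :
    (K.src e ++ (K.tgt e ++ R ++ es.flatMap K.tgt)).Nodup := by
  refine (List.Perm.nodup_iff ?_).1 hn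
  refine (h.append_right _).trans ?_
  rw [List.append_assoc, List.flatMap_cons, ← List.append_assoc R]
  exact (List.perm_append_comm.append_right _).append_left _

/-- A hyperedge whose sources are present at the start depends on none of those performed before it,
so it can be exchanged with them one at a time. -/
theorem move_front [DecidableEq K.Edge] {L M : List K.Node} {e : K.Edge} {es : List K.Edge}
    {D : Arrow S} (h : K.Exec L es M D) (he : e ∈ es) (hs : K.src e ⊆ L)
    (hn : (L ++ es.flatMap K.tgt).Nodup) : K.Exec L (e :: es.erase e) M D := by
  induction h with
  | nil => simp at he
  | @cons L R M f es P D h h' ih =>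
    by_cases hf : f = e
    · subst hf
      rw [List.erase_cons_head]
      exact cons h h'
    · have he' : e ∈ es := by simpa [Ne.symm hf] using he
      have hn' := nodup_of_perm hn h.perm
      -- If `f` consumed a source of `e`, that node would have to reappear as a wire or a later
      -- target for `e` to use it, which distinctness forbids.
      have hR : K.src e ⊆ K.tgt f ++ R := by
        intro x hx
        refine List.mem_append_right _
          ((List.mem_append.1 (h.perm.subset (hs hx))).resolve_left fun hx' => ?_)
        exact List.disjoint_of_nodup_append hn' hx' (h'.perm.symm.subset
          (List.mem_append_left _ (List.mem_flatMap_of_mem he' hx)))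
      rw [List.flatMap_cons, ← List.append_assoc] at hn
      have hn₁ := (List.nodup_append'.1 hn).1
      rw [List.erase_cons_tail (by simpa using hf)]
      exact (cons h (ih he' hR (List.nodup_append'.1 hn').2.1)).swap hn₁
        fun x hx hx' => List.disjoint_of_nodup_append hn₁ (hs hx') hx

/-- The arrow does not depend on the order in which the hyperedges are performed. -/
theorem unique {L M : List K.Node} {es es' : List K.Edge} {D E : Arrow S}
    (h : K.Exec L es M D) (h' : K.Exec L es' M E) (he : es.Perm es')
    (hn : (L ++ es.flatMap K.tgt).Nodup) : D = E := by
  classical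
  induction es' generalizing L es D E with
  | nil =>
    obtain rfl := he.eq_nil
    cases h with
    | nil h =>
      cases h' with
      | nil h' => exact h.unique h' (by simpa using hn)
  | cons e es' ih =>
    -- The second run begins with `e`, so the sources of `e` lie in `L` and `e` may be moved to the
    -- front of the first run as well.
    have h₁ := h.move_front (he.symm.subset List.mem_cons_self) h'.src_subset hn
    have he' : (es.erase e).Perm es' := by simpa using he.erase e
    cases h' with
    | @cons _ R _ _ _ P E hP h' =>
      obtain ⟨D', hD', rfl⟩ := h₁.cons_inv (List.nodup_append'.1 hn).1 hP
      have hn' : (L ++ (e :: es.erase e).flatMap K.tgt).Nodup :=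
        (List.Perm.nodup_iff (((he.trans (he'.symm.cons e)).flatMap_right _).append_left L)).1 hn
      rw [ih hD' h' he' (List.nodup_append'.1 (nodup_of_perm hn' hP.perm)).2.1]

end Exec

end Hypergraph

/-! ### Parts of a hypergraph described by terms -/

theorem append_inj_of_map_eq {α β : Type*} {l : α → β} {L₁ L₂ M₁ M₂ : List α} {a : List β}
    (h₁ : L₁.map l = a) (h₂ : L₂.map l = a) (h : L₁ ++ M₁ = L₂ ++ M₂) : L₁ = L₂ ∧ M₁ = M₂ :=
  List.append_inj h (by simpa using congrArg List.length (h₁.trans h₂.symm))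

namespace Hypergraph

variable (K : Hypergraph S)

/-- The term describes the part of the hypergraph `K` consisting of the hyperedges in `E` and the
nodes in `N`, with the given lists of nodes as interfaces. -/
def Occurs : {a b : List S.Obj} → Term S a b →
    Set K.Edge → Set K.Node → List K.Node → List K.Node → Prop
  | _, _, .op d, E, N, L, M => ∃ e, K.edgeLabel e = d ∧ E = {e} ∧ N = {z | z ∈ L ++ M} ∧
      L = K.src e ∧ M = K.tgt e ∧ (L ++ M).Nodup
  | _, _, .id x, E, N, L, M => ∃ p, K.nodeLabel p = x ∧ E = ∅ ∧ N = {z | z ∈ [p]} ∧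
      L = [p] ∧ M = [p]
  | _, _, .sym x y, E, N, L, M => ∃ p q, K.nodeLabel p = x ∧ K.nodeLabel q = y ∧ p ≠ q ∧
      E = ∅ ∧ N = {z | z ∈ [p, q]} ∧ L = [p, q] ∧ M = [q, p]
  | _, _, .null, E, N, L, M => E = ∅ ∧ N = ∅ ∧ L = [] ∧ M = []
  -- The parts may share only nodes of the middle interface, which is what a pushout along injective
  -- maps looks like from inside `K`.
  | _, _, .comp s t, E, N, L, M => ∃ E₁ E₂ N₁ N₂ R, Occurs s E₁ N₁ L R ∧ Occurs t E₂ N₂ R M ∧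
      Disjoint E₁ E₂ ∧ (∀ x ∈ N₁, x ∈ N₂ → x ∈ R) ∧ E = E₁ ∪ E₂ ∧ N = N₁ ∪ N₂
  | _, _, .par s t, E, N, L, M => ∃ E₁ E₂ N₁ N₂ L₁ L₂ M₁ M₂, Occurs s E₁ N₁ L₁ M₁ ∧
      Occurs t E₂ N₂ L₂ M₂ ∧ Disjoint E₁ E₂ ∧ Disjoint N₁ N₂ ∧ E = E₁ ∪ E₂ ∧ N = N₁ ∪ N₂ ∧
      L = L₁ ++ L₂ ∧ M = M₁ ++ M₂

namespace Occurs

variable {K} {E : Set K.Edge} {N : Set K.Node} {L M : List K.Node}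

theorem interfaces {a b : List S.Obj} {t : Term S a b} (h : K.Occurs t E N L M) :
    (L.Nodup ∧ ∀ x ∈ L, x ∈ N) ∧ (M.Nodup ∧ ∀ x ∈ M, x ∈ N) ∧
      L.map K.nodeLabel = a ∧ M.map K.nodeLabel = b := by
  induction t generalizing E N L M with
  | op d =>
    obtain ⟨e, rfl, rfl, rfl, rfl, rfl, hn⟩ := h
    have := List.nodup_append'.1 hn
    exact ⟨⟨this.1, by simp +contextual⟩, ⟨this.2.1, by simp +contextual⟩, K.src_label e,
      K.tgt_label e⟩
  | id x =>
    obtain ⟨p, rfl, rfl, rfl, rfl, rfl⟩ := h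
    simp
  | sym x y =>
    obtain ⟨p, q, rfl, rfl, hpq, rfl, rfl, rfl, rfl⟩ := h
    simp [hpq, hpq.symm]
  | null =>
    obtain ⟨rfl, rfl, rfl, rfl⟩ := h
    simp
  | comp s t ihs iht =>
    obtain ⟨E₁, E₂, N₁, N₂, R, hs, ht, hE, hN, rfl, rfl⟩ := h
    obtain ⟨h₁, -, h₂, -⟩ := ihs hs
    obtain ⟨-, h₃, -, h₄⟩ := iht ht
    exact ⟨⟨h₁.1, fun x hx => .inl (h₁.2 x hx)⟩, ⟨h₃.1, fun x hx => .inr (h₃.2 x hx)⟩, h₂, h₄⟩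
  | par s t ihs iht =>
    obtain ⟨E₁, E₂, N₁, N₂, L₁, L₂, M₁, M₂, hs, ht, hE, hN, rfl, rfl, rfl, rfl⟩ := h
    obtain ⟨h₁, h₂, h₃, h₄⟩ := ihs hs
    obtain ⟨h₁', h₂', h₃', h₄'⟩ := iht ht
    rw [Set.disjoint_left] at hN
    refine ⟨⟨List.nodup_append'.2 ⟨h₁.1, h₁'.1, fun x hx hx' => hN (h₁.2 x hx) (h₁'.2 x hx')⟩, ?_⟩,
      ⟨List.nodup_append'.2 ⟨h₂.1, h₂'.1, fun x hx hx' => hN (h₂.2 x hx) (h₂'.2 x hx')⟩, ?_⟩,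
      by simp [h₃, h₃'], by simp [h₄, h₄']⟩
    · intro x hx
      exact (List.mem_append.1 hx).imp (h₁.2 x) (h₁'.2 x)
    · intro x hx
      exact (List.mem_append.1 hx).imp (h₂.2 x) (h₂'.2 x)

theorem castHom_iff {a a' b b' : List S.Obj} (ha : a = a') (hb : b = b') (t : Term S a b) :
    K.Occurs (castHom ha hb t) E N L M ↔ K.Occurs t E N L M := by
  subst ha hb; rfl

/-- With `symX_iff` and `symW_iff`, a closed form for the recursively defined terms, so that the
laws can be checked without induction on words. -/
theorem idW_iff {a : List S.Obj} : K.Occurs (Term.idW a) E N L M ↔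
    L.Nodup ∧ L.map K.nodeLabel = a ∧ E = ∅ ∧ N = {z | z ∈ L} ∧ M = L := by
  induction a generalizing E N L M with
  | nil =>
    constructor
    · rintro ⟨rfl, rfl, rfl, rfl⟩
      simp
    · rintro ⟨-, h, rfl, rfl, rfl⟩
      obtain rfl := List.map_eq_nil_iff.1 h
      simp [Term.idW, Occurs]
  | cons x a ih =>
    constructor
    · rintro ⟨E₁, E₂, N₁, N₂, L₁, L₂, M₁, M₂, ⟨p, rfl, rfl, rfl, rfl, rfl⟩, ht, hE, hN, rfl, rfl,
        rfl, rfl⟩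
      obtain ⟨h₁, rfl, rfl, rfl, rfl⟩ := ih.1 ht
      refine ⟨List.nodup_append'.2 ⟨by simp, h₁, ?_⟩, rfl, by simp, by ext; simp, rfl⟩
      exact fun x hx hx' => Set.disjoint_left.1 hN hx hx'
    · rintro ⟨hn, h, rfl, rfl, rfl⟩
      obtain ⟨p, L, rfl, rfl, rfl⟩ := List.map_eq_cons_iff.1 h
      obtain ⟨h₁, h₂⟩ := List.nodup_cons.1 hn
      refine ⟨∅, ∅, _, _, [p], L, [p], L, ⟨p, rfl, rfl, rfl, rfl, rfl⟩,
        ih.2 ⟨h₂, rfl, rfl, rfl, rfl⟩, by simp, ?_, by simp, by ext; simp, rfl, rfl⟩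
      simpa using h₁

theorem symX_iff {x : S.Obj} {b : List S.Obj} : K.Occurs (Term.symX x b) E N L M ↔
    ∃ p B, K.nodeLabel p = x ∧ B.map K.nodeLabel = b ∧ (p :: B).Nodup ∧ E = ∅ ∧
      N = {z | z ∈ p :: B} ∧ L = p :: B ∧ M = B ++ [p] := by
  induction b generalizing E N L M with
  | nil =>
    constructor
    · rintro ⟨p, rfl, rfl, rfl, rfl, rfl⟩
      exact ⟨p, [], by simp⟩
    · rintro ⟨p, B, rfl, h, hn, rfl, rfl, rfl, rfl⟩
      obtain rfl := List.map_eq_nil_iff.1 h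
      exact ⟨p, by simp⟩
  | cons y b ih =>
    constructor
    · rintro ⟨E₁, E₂, N₁, N₂, R, ⟨E₃, E₄, N₃, N₄, L₁, L₂, M₁, M₂, ⟨p, q, rfl, rfl, hpq, rfl, rfl,
        rfl, rfl⟩, hi, -, hN, rfl, rfl, rfl, rfl⟩, ⟨E₅, E₆, N₅, N₆, L₃, L₄, M₃, M₄, ⟨q', hq, rfl,
        rfl, rfl, rfl⟩, hs, -, hN', rfl, rfl, hL, rfl⟩, hE, hN'', rfl, rfl⟩
      obtain ⟨h₁, h₂, rfl, rfl, rfl⟩ := idW_iff.1 hi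
      obtain ⟨p', B, hp, h₃, h₄, rfl, rfl, rfl, rfl⟩ := ih.1 hs
      simp only [List.cons_append, List.nil_append, List.cons.injEq] at hL
      obtain ⟨rfl, rfl, rfl⟩ := hL
      refine ⟨p, q :: M₂, rfl, by simp [h₂], ?_, by simp, ?_, rfl, rfl⟩
      · have := List.nodup_append'.2 ⟨by simpa using hpq, h₁, fun x hx hx' =>
          Set.disjoint_left.1 hN hx hx'⟩
        exact this
      · ext; simp; tauto
    · rintro ⟨p, B, rfl, h, hn, rfl, rfl, rfl, rfl⟩
      obtain ⟨q, B, rfl, rfl, rfl⟩ := List.map_eq_cons_iff.1 h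
      simp only [List.nodup_cons, List.mem_cons, not_or] at hn
      refine ⟨∅, ∅, _, _, q :: p :: B, ⟨∅, ∅, _, _, [p, q], B, [q, p], B, ⟨p, q, rfl, rfl, hn.1.1,
        rfl, rfl, rfl, rfl⟩, idW_iff.2 ⟨hn.2.2, rfl, rfl, rfl, rfl⟩, by simp, ?_, by simp, rfl,
        rfl, rfl⟩, ⟨∅, ∅, _, _, [q], p :: B, [q], B ++ [p], ⟨q, rfl, rfl, rfl, rfl, rfl⟩,
        ih.2 ⟨p, B, rfl, rfl, ?_, rfl, rfl, rfl, rfl⟩, by simp, ?_, by simp, rfl, rfl, rfl⟩,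
        by simp, ?_, by simp, ?_⟩
      all_goals clear ih
      · rw [Set.disjoint_left]; grind
      · grind
      · rw [Set.disjoint_left]; grind
      · grind
      · grind

theorem symW_iff {a b : List S.Obj} : K.Occurs (Term.symW a b) E N L M ↔
    ∃ A B, A.map K.nodeLabel = a ∧ B.map K.nodeLabel = b ∧ (A ++ B).Nodup ∧ E = ∅ ∧
      N = {z | z ∈ A ++ B} ∧ L = A ++ B ∧ M = B ++ A := by
  induction a generalizing E N L M with
  | nil =>
    refine (castHom_iff _ _ _).trans (idW_iff.trans ?_)
    constructor
    · rintro ⟨h₁, rfl, rfl, rfl, rfl⟩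
      exact ⟨[], M, by simp [h₁]⟩
    · rintro ⟨A, B, h, rfl, hn, rfl, rfl, rfl, rfl⟩
      obtain rfl := List.map_eq_nil_iff.1 h
      simpa using hn
  | cons x a ih =>
    rw [Term.symW, castHom_iff]
    constructor
    · rintro ⟨E₁, E₂, N₁, N₂, R, ⟨E₃, E₄, N₃, N₄, L₁, L₂, M₁, M₂, ⟨p, rfl, rfl, rfl, rfl, rfl⟩,
        hi, -, hN, rfl, rfl, rfl, rfl⟩, ⟨E₅, E₆, N₅, N₆, L₃, L₄, M₃, M₄, hx, hs, -, hN', rfl, rfl,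
        hL, rfl⟩, hE, hN'', rfl, rfl⟩
      obtain ⟨A, B, rfl, rfl, h₁, rfl, rfl, rfl, rfl⟩ := ih.1 hi
      obtain ⟨p', B', hp, h₂, h₃, rfl, rfl, rfl, rfl⟩ := symX_iff.1 hx
      obtain ⟨h₄, h₅, rfl, rfl, rfl⟩ := idW_iff.1 hs
      simp only [List.cons_append, List.nil_append, List.cons.injEq] at hL
      obtain ⟨rfl, hL⟩ := hL
      obtain ⟨rfl, rfl⟩ := append_inj_of_map_eq rfl h₂ hL
      refine ⟨p :: A, B, rfl, rfl, ?_, by simp, ?_, rfl, by simp⟩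
      · exact List.nodup_cons.2 ⟨Set.disjoint_left.1 hN (by simp), h₁⟩
      · clear ih hi hx hs
        ext
        simp
        tauto
    · rintro ⟨A, B, h, rfl, hn, rfl, rfl, rfl, rfl⟩
      obtain ⟨p, A, rfl, rfl, rfl⟩ := List.map_eq_cons_iff.1 h
      refine ⟨∅, ∅, _, _, p :: (B ++ A), ⟨∅, ∅, _, _, [p], A ++ B, [p], B ++ A,
        ⟨p, rfl, rfl, rfl, rfl, rfl⟩, ih.2 ⟨A, B, rfl, rfl, ?_, rfl, rfl, rfl, rfl⟩, by simp,
        ?_, by simp, rfl, rfl, rfl⟩, ⟨∅, ∅, _, _, p :: B, A, B ++ [p], A,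
        symX_iff.2 ⟨p, B, rfl, rfl, ?_, rfl, rfl, rfl, rfl⟩,
        idW_iff.2 ⟨?_, rfl, rfl, rfl, rfl⟩, by simp, ?_, by simp, rfl, rfl, by simp⟩,
        by simp, ?_, by simp, ?_⟩
      all_goals clear ih
      · grind
      · rw [Set.disjoint_left]; grind
      · grind
      · grind
      · rw [Set.disjoint_left]; grind
      · grind
      · grind

end Occurs

end Hypergraph

/-! ### Invariance of occurrence under the laws -/

namespace Hypergraph.Occurs

variable {K : Hypergraph S} {E : Set K.Edge} {N : Set K.Node} {L M : List K.Node}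

theorem comp_congr {a b c : List S.Obj} {s s' : Term S a b} {t t' : Term S b c}
    (h : ∀ {E N L M}, K.Occurs s E N L M → K.Occurs s' E N L M)
    (h' : ∀ {E N L M}, K.Occurs t E N L M → K.Occurs t' E N L M)
    (H : K.Occurs (s.comp t) E N L M) : K.Occurs (s'.comp t') E N L M := by
  obtain ⟨E₁, E₂, N₁, N₂, R, hs, ht, H⟩ := H
  exact ⟨E₁, E₂, N₁, N₂, R, h hs, h' ht, H⟩

theorem par_congr {a b c d : List S.Obj} {s s' : Term S a b} {t t' : Term S c d}
    (h : ∀ {E N L M}, K.Occurs s E N L M → K.Occurs s' E N L M)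
    (h' : ∀ {E N L M}, K.Occurs t E N L M → K.Occurs t' E N L M)
    (H : K.Occurs (s.par t) E N L M) : K.Occurs (s'.par t') E N L M := by
  obtain ⟨E₁, E₂, N₁, N₂, L₁, L₂, M₁, M₂, hs, ht, H⟩ := H
  exact ⟨E₁, E₂, N₁, N₂, L₁, L₂, M₁, M₂, h hs, h' ht, H⟩

theorem assoc_iff {a b c d : List S.Obj} (r : Term S a b) (s : Term S b c) (t : Term S c d) :
    K.Occurs ((r.comp s).comp t) E N L M ↔ K.Occurs (r.comp (s.comp t)) E N L M := by
  constructor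
  · rintro ⟨_, E₃, _, N₃, R₂, ⟨E₁, E₂, N₁, N₂, R₁, hr, hs, hE, hN, rfl, rfl⟩, ht, hE', hN', rfl,
      rfl⟩
    obtain ⟨hE₁, hE₂⟩ := Set.disjoint_union_left.1 hE'
    refine ⟨E₁, _, N₁, _, R₁, hr, ⟨E₂, E₃, N₂, N₃, R₂, hs, ht, hE₂, fun x hx => hN' x (.inr hx),
      rfl, rfl⟩, Set.disjoint_union_right.2 ⟨hE, hE₁⟩, ?_, Set.union_assoc _ _ _,
      Set.union_assoc _ _ _⟩
    -- A node shared by the first and the third part lies in `R₂`, hence in the second part, hence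
    -- in `R₁`.
    rintro x hx (hx' | hx')
    · exact hN x hx hx'
    · exact hN x hx (hs.interfaces.2.1.2 x (hN' x (.inl hx) hx'))
  · rintro ⟨E₁, _, N₁, _, R₁, hr, ⟨E₂, E₃, N₂, N₃, R₂, hs, ht, hE, hN, rfl, rfl⟩, hE', hN', rfl,
      rfl⟩
    obtain ⟨hE₁, hE₂⟩ := Set.disjoint_union_right.1 hE'
    refine ⟨_, E₃, _, N₃, R₂, ⟨E₁, E₂, N₁, N₂, R₁, hr, hs, hE₁, fun x hx hx' => hN' x hx (.inl hx'),
      rfl, rfl⟩, ht, Set.disjoint_union_left.2 ⟨hE₂, hE⟩, ?_, (Set.union_assoc _ _ _).symm,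
      (Set.union_assoc _ _ _).symm⟩
    rintro x (hx | hx) hx'
    · exact hN x (hs.interfaces.1.2 x (hN' x hx (.inr hx'))) hx'
    · exact hN x hx hx'

theorem id_comp_iff {a b : List S.Obj} (t : Term S a b) :
    K.Occurs ((Term.idW a).comp t) E N L M ↔ K.Occurs t E N L M := by
  constructor
  · rintro ⟨E₁, E₂, N₁, N₂, R, hi, ht, -, -, rfl, rfl⟩
    obtain ⟨-, -, rfl, rfl, rfl⟩ := idW_iff.1 hi
    have hN : {z | z ∈ R} ⊆ N₂ := ht.interfaces.1.2
    rwa [Set.empty_union, Set.union_eq_self_of_subset_left hN]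
  · intro ht
    have h := ht.interfaces
    exact ⟨∅, E, _, N, L, idW_iff.2 ⟨h.1.1, h.2.2.1, rfl, rfl, rfl⟩, ht, by simp, fun x hx _ => hx,
      by simp, (Set.union_eq_self_of_subset_left h.1.2).symm⟩

theorem comp_id_iff {a b : List S.Obj} (t : Term S a b) :
    K.Occurs (t.comp (Term.idW b)) E N L M ↔ K.Occurs t E N L M := by
  constructor
  · rintro ⟨E₁, E₂, N₁, N₂, R, ht, hi, -, -, rfl, rfl⟩
    obtain ⟨-, -, rfl, rfl, rfl⟩ := idW_iff.1 hi
    have hN : {z | z ∈ M} ⊆ N₁ := ht.interfaces.2.1.2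
    rwa [Set.union_empty, Set.union_eq_self_of_subset_right hN]
  · intro ht
    have h := ht.interfaces
    exact ⟨E, ∅, N, _, M, ht, idW_iff.2 ⟨h.2.1.1, h.2.2.2, rfl, rfl, rfl⟩, by simp, fun x _ hx => hx,
      by simp, (Set.union_eq_self_of_subset_right h.2.1.2).symm⟩

theorem interchange_iff {a b c a' b' c' : List S.Obj} (s : Term S a b) (t : Term S b c)
    (s' : Term S a' b') (t' : Term S b' c') :
    K.Occurs ((s.par s').comp (t.par t')) E N L M ↔
      K.Occurs ((s.comp t).par (s'.comp t')) E N L M := by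
  constructor
  · rintro ⟨_, _, _, _, _, ⟨E₁, E₂, N₁, N₂, L₁, L₂, M₁, M₂, hs, hs', hE, hN, rfl, rfl, rfl, rfl⟩,
      ⟨E₃, E₄, N₃, N₄, L₃, L₄, M₃, M₄, ht, ht', hE', hN', rfl, rfl, hL, rfl⟩, hE'', hN'', rfl, rfl⟩
    obtain ⟨rfl, rfl⟩ := append_inj_of_map_eq hs.interfaces.2.2.2 ht.interfaces.2.2.1 hL
    have h₁ := hs.interfaces
    have h₂ := hs'.interfaces
    have h₃ := ht.interfaces
    have h₄ := ht'.interfaces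
    simp only [Set.disjoint_union_left, Set.disjoint_union_right] at hE''
    rw [Set.disjoint_left] at hN hN'
    -- Nodes common to the two sequential stages lie in `M₁` or `M₂`; disjointness of the parallel
    -- factors decides which, and excludes any node common to the two new factors.
    have key : ∀ x ∈ N₁ ∪ N₂, x ∈ N₃ ∪ N₄ → x ∈ M₁ ∨ x ∈ M₂ :=
      fun x hx hx' => List.mem_append.1 (hN'' x hx hx')
    refine ⟨_, _, _, _, L₁, L₂, M₃, M₄, ⟨E₁, E₃, N₁, N₃, M₁, hs, ht, hE''.1.1, ?_, rfl, rfl⟩,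
      ⟨E₂, E₄, N₂, N₄, M₂, hs', ht', hE''.2.2, ?_, rfl, rfl⟩, ?_, ?_,
      Set.union_union_union_comm _ _ _ _, Set.union_union_union_comm _ _ _ _, rfl, rfl⟩
    · exact fun x hx hx' => (key x (.inl hx) (.inl hx')).resolve_right
        fun h => hN hx (h₂.2.1.2 x h)
    · exact fun x hx hx' => (key x (.inr hx) (.inr hx')).resolve_left
        fun h => hN (h₁.2.1.2 x h) hx
    · simp [Set.disjoint_union_left, Set.disjoint_union_right, hE, hE', hE''.1.2.symm, hE''.2.1]
    · rw [Set.disjoint_left]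
      rintro x (hx | hx) (hx' | hx')
      · exact hN hx hx'
      · rcases key x (.inl hx) (.inr hx') with h | h
        · exact hN' (h₃.1.2 x h) hx'
        · exact hN hx (h₂.2.1.2 x h)
      · rcases key x (.inr hx') (.inl hx) with h | h
        · exact hN (h₁.2.1.2 x h) hx'
        · exact hN' hx (h₄.1.2 x h)
      · exact hN' hx hx'
  · rintro ⟨_, _, _, _, _, _, _, _, ⟨E₁, E₃, N₁, N₃, M₁, hs, ht, hE, hN, rfl, rfl⟩,
      ⟨E₂, E₄, N₂, N₄, M₂, hs', ht', hE', hN', rfl, rfl⟩, hE'', hN'', rfl, rfl, rfl, rfl⟩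
    simp only [Set.disjoint_union_left, Set.disjoint_union_right] at hE'' hN''
    refine ⟨_, _, _, _, _, ⟨E₁, E₂, N₁, N₂, _, _, M₁, M₂, hs, hs', hE''.1.1, hN''.1.1, rfl, rfl,
      rfl, rfl⟩, ⟨E₃, E₄, N₃, N₄, _, _, _, _, ht, ht', hE''.2.2, hN''.2.2, rfl, rfl, rfl, rfl⟩,
      ?_, ?_, Set.union_union_union_comm _ _ _ _, Set.union_union_union_comm _ _ _ _⟩
    · simp [Set.disjoint_union_left, Set.disjoint_union_right, hE, hE', hE''.1.2.symm, hE''.2.1]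
    · rintro x (hx | hx) (hx' | hx')
      · exact List.mem_append_left _ (hN x hx hx')
      · exact absurd hx' (Set.disjoint_left.1 hN''.2.1 hx)
      · exact absurd hx (Set.disjoint_left.1 hN''.1.2 hx')
      · exact List.mem_append_right _ (hN' x hx hx')

theorem par_assoc_iff {a b a' b' a'' b'' : List S.Obj} (r : Term S a b) (s : Term S a' b')
    (t : Term S a'' b'') :
    K.Occurs ((r.par s).par t) E N L M ↔ K.Occurs (r.par (s.par t)) E N L M := by
  constructor
  · rintro ⟨_, E₃, _, N₃, _, L₃, _, M₃, ⟨E₁, E₂, N₁, N₂, L₁, L₂, M₁, M₂, hr, hs, hE, hN, rfl, rfl,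
      rfl, rfl⟩, ht, hE', hN', rfl, rfl, rfl, rfl⟩
    obtain ⟨hE₁, hE₂⟩ := Set.disjoint_union_left.1 hE'
    obtain ⟨hN₁, hN₂⟩ := Set.disjoint_union_left.1 hN'
    exact ⟨E₁, _, N₁, _, L₁, _, M₁, _, hr, ⟨E₂, E₃, N₂, N₃, L₂, L₃, M₂, M₃, hs, ht, hE₂, hN₂, rfl,
      rfl, rfl, rfl⟩, Set.disjoint_union_right.2 ⟨hE, hE₁⟩, Set.disjoint_union_right.2 ⟨hN, hN₁⟩,
      Set.union_assoc _ _ _, Set.union_assoc _ _ _, List.append_assoc _ _ _,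
      List.append_assoc _ _ _⟩
  · rintro ⟨E₁, _, N₁, _, L₁, _, M₁, _, hr, ⟨E₂, E₃, N₂, N₃, L₂, L₃, M₂, M₃, hs, ht, hE, hN, rfl,
      rfl, rfl, rfl⟩, hE', hN', rfl, rfl, rfl, rfl⟩
    obtain ⟨hE₁, hE₂⟩ := Set.disjoint_union_right.1 hE'
    obtain ⟨hN₁, hN₂⟩ := Set.disjoint_union_right.1 hN'
    exact ⟨_, E₃, _, N₃, _, L₃, _, M₃, ⟨E₁, E₂, N₁, N₂, L₁, L₂, M₁, M₂, hr, hs, hE₁, hN₁, rfl,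
      rfl, rfl, rfl⟩, ht, Set.disjoint_union_left.2 ⟨hE₂, hE⟩, Set.disjoint_union_left.2 ⟨hN₂, hN⟩,
      (Set.union_assoc _ _ _).symm, (Set.union_assoc _ _ _).symm, (List.append_assoc _ _ _).symm,
      (List.append_assoc _ _ _).symm⟩

theorem null_par_iff {a b : List S.Obj} (t : Term S a b) :
    K.Occurs (Term.null.par t) E N L M ↔ K.Occurs t E N L M := by
  constructor
  · rintro ⟨_, E₃, _, N₃, _, L₃, _, M₃, ⟨rfl, rfl, rfl, rfl⟩, ht, -, -, rfl, rfl, rfl, rfl⟩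
    simpa using ht
  · intro ht
    exact ⟨∅, E, ∅, N, [], L, [], M, ⟨rfl, rfl, rfl, rfl⟩, ht, by simp⟩

theorem par_null_iff {a b : List S.Obj} (t : Term S a b) :
    K.Occurs (t.par Term.null) E N L M ↔ K.Occurs t E N L M := by
  constructor
  · rintro ⟨_, E₃, _, N₃, _, L₃, _, M₃, ht, ⟨rfl, rfl, rfl, rfl⟩, -, -, rfl, rfl, rfl, rfl⟩
    simpa using ht
  · intro ht
    exact ⟨E, ∅, N, ∅, L, [], M, [], ht, ⟨rfl, rfl, rfl, rfl⟩, by simp⟩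

/-- Identities and symmetries add no hyperedges and no nodes beyond their interfaces, so both sides
amount to an occurrence of `t` and a disjoint list of nodes labelled by `a`. -/
theorem sym_natural_iff (a : List S.Obj) {b c : List S.Obj} (t : Term S b c) :
    K.Occurs (((Term.idW a).par t).comp (Term.symW a c)) E N L M ↔
      K.Occurs ((Term.symW a b).comp (t.par (Term.idW a))) E N L M := by
  constructor
  · rintro ⟨_, _, _, _, _, ⟨E₁, E₂, N₁, N₂, L₁, L₂, M₁, M₂, hi, ht, -, hN, rfl, rfl, rfl, rfl⟩,
      hs, -, -, rfl, rfl⟩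
    obtain ⟨h₁, rfl, rfl, rfl, rfl⟩ := idW_iff.1 hi
    obtain ⟨A, C, hA, hC, hn, rfl, rfl, hL, rfl⟩ := symW_iff.1 hs
    obtain ⟨rfl, rfl⟩ := append_inj_of_map_eq rfl hA hL
    have h := ht.interfaces
    have hN' : ∀ x ∈ M₁, x ∉ N₂ := fun x hx hx' => Set.disjoint_left.1 hN hx hx'
    refine ⟨∅, _, _, _, L₂ ++ M₁, symW_iff.2 ⟨M₁, L₂, rfl, h.2.2.1, ?_, rfl, rfl, rfl, rfl⟩,
      ⟨E₂, ∅, N₂, _, L₂, M₁, M₂, M₁, ht, hi, by simp, hN.symm, rfl, rfl, rfl, rfl⟩, by simp,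
      ?_, by simp, ?_⟩
    · exact List.nodup_append'.2 ⟨h₁, h.1.1, fun x hx hx' => hN' x hx (h.1.2 x hx')⟩
    · intro x hx _
      simpa [or_comm] using hx
    · ext x
      have := h.1.2 x
      have := h.2.1.2 x
      simp only [Set.mem_union, List.mem_append, Set.mem_ofPred_eq]
      tauto
  · rintro ⟨_, _, _, _, _, hs, ⟨E₁, E₂, N₁, N₂, L₁, L₂, M₁, M₂, ht, hi, -, hN, rfl, rfl, hL, rfl⟩,
      -, -, rfl, rfl⟩
    obtain ⟨h₁, hA', rfl, rfl, rfl⟩ := idW_iff.1 hi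
    obtain ⟨A, B, hA, hB, hn, rfl, rfl, rfl, rfl⟩ := symW_iff.1 hs
    have h := ht.interfaces
    obtain ⟨rfl, rfl⟩ := append_inj_of_map_eq hB h.2.2.1 hL
    have hN' : ∀ x ∈ A, x ∉ N₁ := fun x hx hx' => Set.disjoint_left.1 hN hx' hx
    refine ⟨_, ∅, _, _, A ++ M₁, ⟨∅, E₁, _, N₁, A, B, A, M₁, hi, ht, by simp, hN.symm, rfl, rfl,
      rfl, rfl⟩, symW_iff.2 ⟨A, M₁, hA, h.2.2.2, ?_, rfl, rfl, rfl, rfl⟩, by simp, ?_, by simp, ?_⟩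
    · exact List.nodup_append'.2 ⟨h₁, h.2.1.1, fun x hx hx' => hN' x hx (h.2.1.2 x hx')⟩
    · exact fun x _ hx => hx
    · ext x
      have := h.1.2 x
      have := h.2.1.2 x
      simp only [Set.mem_union, List.mem_append, Set.mem_ofPred_eq]
      tauto

theorem sym_iso_iff (a b : List S.Obj) :
    K.Occurs ((Term.symW a b).comp (Term.symW b a)) E N L M ↔
      K.Occurs ((Term.idW a).par (Term.idW b)) E N L M := by
  constructor
  · rintro ⟨_, _, _, _, _, h, h', -, -, rfl, rfl⟩
    obtain ⟨A, B, hA, hB, hn, rfl, rfl, rfl, rfl⟩ := symW_iff.1 h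
    obtain ⟨B', A', hB', hA', -, rfl, rfl, hL, rfl⟩ := symW_iff.1 h'
    obtain ⟨rfl, rfl⟩ := append_inj_of_map_eq hB hB' hL
    obtain ⟨h₁, h₂, h₃⟩ := List.nodup_append'.1 hn
    refine ⟨∅, ∅, _, _, A, B, A, B, idW_iff.2 ⟨h₁, hA, rfl, rfl, rfl⟩,
      idW_iff.2 ⟨h₂, hB, rfl, rfl, rfl⟩, by simp, Set.disjoint_left.2 h₃, by simp, ?_, rfl, rfl⟩
    ext
    simp
    tauto
  · rintro ⟨_, _, _, _, _, _, A, B, h, h', -, hN, rfl, rfl, rfl, rfl⟩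
    obtain ⟨h₁, hA, rfl, rfl, rfl⟩ := idW_iff.1 h
    obtain ⟨h₂, hB, rfl, rfl, rfl⟩ := idW_iff.1 h'
    have h₃ : List.Disjoint A B := fun x hx hx' => Set.disjoint_left.1 hN hx hx'
    refine ⟨∅, ∅, _, _, B ++ A, symW_iff.2 ⟨A, B, hA, hB, List.nodup_append'.2 ⟨h₁, h₂, h₃⟩, rfl,
      rfl, rfl, rfl⟩, symW_iff.2 ⟨B, A, hB, hA, List.nodup_append'.2 ⟨h₂, h₁, h₃.symm⟩, rfl,
      rfl, rfl, rfl⟩, by simp, ?_, by simp, ?_⟩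
    · exact fun x _ hx => hx
    · ext
      simp
      tauto

theorem iff_of_eqv {a b : List S.Obj} {s t : Term S a b} (h : Term.Eqv s t) :
    K.Occurs s E N L M ↔ K.Occurs t E N L M := by
  induction h generalizing E N L M with
  | refl => rfl
  | symm _ ih => exact ih.symm
  | trans _ _ ih₁ ih₂ => exact ih₁.trans ih₂
  | comp_congr _ _ ih₁ ih₂ => exact ⟨comp_congr ih₁.1 ih₂.1, comp_congr ih₁.2 ih₂.2⟩
  | par_congr _ _ ih₁ ih₂ => exact ⟨par_congr ih₁.1 ih₂.1, par_congr ih₁.2 ih₂.2⟩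
  | assoc r s t => exact assoc_iff r s t
  | id_comp t => exact id_comp_iff t
  | comp_id t => exact comp_id_iff t
  | interchange s t s' t' => exact interchange_iff s t s' t'
  | par_assoc r s t => exact (castHom_iff _ _ _).trans (par_assoc_iff r s t)
  | null_par t => exact null_par_iff t
  | par_null t => exact (castHom_iff _ _ _).trans (par_null_iff t)
  | sym_natural a t => exact sym_natural_iff a t
  | sym_iso a b => exact sym_iso_iff a b

end Hypergraph.Occurs

/-! ### Embeddings, and the occurrence of a term in its interpretation -/

namespace Hypergraph

/-- Injective morphisms of hypergraphs. -/
structure IsEmbedding (K K' : Hypergraph S) (f : K.Node → K'.Node) (g : K.Edge → K'.Edge) :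
    Prop where
  node_injective : f.Injective
  edge_injective : g.Injective
  nodeLabel_eq : ∀ x, K'.nodeLabel (f x) = K.nodeLabel x
  edgeLabel_eq : ∀ e, K'.edgeLabel (g e) = K.edgeLabel e
  src_eq : ∀ e, K'.src (g e) = (K.src e).map f
  tgt_eq : ∀ e, K'.tgt (g e) = (K.tgt e).map f

theorem Occurs.map {K K' : Hypergraph S} {f : K.Node → K'.Node} {g : K.Edge → K'.Edge}
    (hfg : IsEmbedding K K' f g) {a b : List S.Obj} {t : Term S a b} {E : Set K.Edge}
    {N : Set K.Node} {L M : List K.Node} (h : K.Occurs t E N L M) :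
    K'.Occurs t (g '' E) (f '' N) (L.map f) (M.map f) := by
  induction t generalizing E N L M with
  | op d =>
    obtain ⟨e, rfl, rfl, rfl, rfl, rfl, hn⟩ := h
    refine ⟨g e, hfg.edgeLabel_eq e, by simp, ?_, (hfg.src_eq e).symm, (hfg.tgt_eq e).symm, ?_⟩
    · ext; simp [Set.mem_image, or_and_right, exists_or]
    · rw [← List.map_append]
      exact hn.map hfg.node_injective
  | id x =>
    obtain ⟨p, rfl, rfl, rfl, rfl, rfl⟩ := h
    exact ⟨f p, hfg.nodeLabel_eq p, by simp⟩
  | sym x y =>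
    obtain ⟨p, q, rfl, rfl, hpq, rfl, rfl, rfl, rfl⟩ := h
    refine ⟨f p, f q, hfg.nodeLabel_eq p, hfg.nodeLabel_eq q, hfg.node_injective.ne hpq, by simp,
      ?_, rfl, rfl⟩
    ext; simp [Set.mem_image, eq_comm]
  | null =>
    obtain ⟨rfl, rfl, rfl, rfl⟩ := h
    exact ⟨by simp, by simp, rfl, rfl⟩
  | comp s t ihs iht =>
    obtain ⟨E₁, E₂, N₁, N₂, R, hs, ht, hE, hN, rfl, rfl⟩ := h
    refine ⟨_, _, _, _, _, ihs hs, iht ht, hE.image hfg.edge_injective.injOn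
      (Set.subset_univ _) (Set.subset_univ _), ?_, Set.image_union _ _ _, Set.image_union _ _ _⟩
    rintro _ ⟨x, hx, rfl⟩ ⟨y, hy, hxy⟩
    obtain rfl := hfg.node_injective hxy
    exact List.mem_map_of_mem (hN _ hx hy)
  | par s t ihs iht =>
    obtain ⟨E₁, E₂, N₁, N₂, L₁, L₂, M₁, M₂, hs, ht, hE, hN, rfl, rfl, rfl, rfl⟩ := h
    exact ⟨_, _, _, _, _, _, _, _, ihs hs, iht ht, hE.image hfg.edge_injective.injOn
      (Set.subset_univ _) (Set.subset_univ _), hN.image hfg.node_injective.injOn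
      (Set.subset_univ _) (Set.subset_univ _), Set.image_union _ _ _, Set.image_union _ _ _,
      List.map_append, List.map_append⟩

end Hypergraph

namespace OpenHypergraph

open StrDiag.Hypergraph

section par

variable {a b a' b' : List S.Obj} (G : OpenHypergraph S a b) (H : OpenHypergraph S a' b')

/-- The inclusion of the nodes of the first factor of a parallel composite. -/
def parNodeLeft : G.Node → (G.par H).Node := Sum.inl

/-- The inclusion of the nodes of the second factor of a parallel composite. -/
def parNodeRight : H.Node → (G.par H).Node := Sum.inr

/-- The inclusion of the hyperedges of the first factor of a parallel composite. -/
def parEdgeLeft : G.Edge → (G.par H).Edge := Sum.inl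

/-- The inclusion of the hyperedges of the second factor of a parallel composite. -/
def parEdgeRight : H.Edge → (G.par H).Edge := Sum.inr

theorem isEmbedding_par_left :
    IsEmbedding G.toHypergraph (G.par H).toHypergraph (G.parNodeLeft H) (G.parEdgeLeft H) :=
  ⟨Sum.inl_injective, Sum.inl_injective, fun _ => rfl, fun _ => rfl, fun _ => rfl, fun _ => rfl⟩

theorem isEmbedding_par_right :
    IsEmbedding H.toHypergraph (G.par H).toHypergraph (G.parNodeRight H) (G.parEdgeRight H) :=
  ⟨Sum.inr_injective, Sum.inr_injective, fun _ => rfl, fun _ => rfl, fun _ => rfl, fun _ => rfl⟩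

variable {G H}

theorem par_occurs {s : Term S a b} {t : Term S a' b'}
    (hs : G.Occurs s Set.univ Set.univ G.left G.right)
    (ht : H.Occurs t Set.univ Set.univ H.left H.right) :
    (G.par H).Occurs (s.par t) Set.univ Set.univ (G.par H).left (G.par H).right := by
  refine ⟨_, _, _, _, _, _, _, _, hs.map (isEmbedding_par_left G H),
    ht.map (isEmbedding_par_right G H), ?_, ?_, ?_, ?_, rfl, rfl⟩
  · refine Set.disjoint_left.2 ?_
    rintro _ ⟨x, -, rfl⟩ ⟨y, -, h⟩
    cases h
  · refine Set.disjoint_left.2 ?_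
    rintro _ ⟨x, -, rfl⟩ ⟨y, -, h⟩
    cases h
  · refine (Set.eq_univ_of_forall ?_).symm
    rintro (e | e)
    · exact .inl ⟨e, trivial, rfl⟩
    · exact .inr ⟨e, trivial, rfl⟩
  · refine (Set.eq_univ_of_forall ?_).symm
    rintro (e | e)
    · exact .inl ⟨e, trivial, rfl⟩
    · exact .inr ⟨e, trivial, rfl⟩

end par

section comp

variable {a b c : List S.Obj} (G : OpenHypergraph S a b) (H : OpenHypergraph S b c)

/-- The inclusion of the nodes of the first factor of a sequential composite. -/
def compNodeLeft (x : G.Node) : (G.comp H).Node := Quot.mk _ (Sum.inl x)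

/-- The inclusion of the nodes of the second factor of a sequential composite. -/
def compNodeRight (x : H.Node) : (G.comp H).Node := Quot.mk _ (Sum.inr x)

/-- The inclusion of the hyperedges of the first factor of a sequential composite. -/
def compEdgeLeft : G.Edge → (G.comp H).Edge := Sum.inl

/-- The inclusion of the hyperedges of the second factor of a sequential composite. -/
def compEdgeRight : H.Edge → (G.comp H).Edge := Sum.inr

variable {G H}

/-- With injective middle interfaces a node is glued to at most one other, so the generated
equivalence needs at most one gluing step. Hence both factors embed in the composite. -/
theorem mk_eq_mk_iff (hG : G.right.Nodup) (hH : H.left.Nodup) {p q : G.Node ⊕ H.Node} :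
    Quot.mk (Glue G H) p = Quot.mk (Glue G H) q ↔ p = q ∨ Glue G H p q ∨ Glue G H q p := by
  constructor
  · intro h
    have key : ∀ {p q}, Relation.EqvGen (Glue G H) p q → p = q ∨ Glue G H p q ∨ Glue G H q p := by
      intro p q h
      induction h with
      | rel p q h => exact .inr (.inl h)
      | refl => exact .inl rfl
      | symm p q _ ih => tauto
      | trans p q r _ _ ih₁ ih₂ =>
        obtain rfl | h₁ := ih₁
        · exact ih₂
        obtain rfl | h₂ := ih₂
        · exact .inr h₁
        left
        -- Gluing relates a left node to a right one, so two successive steps go across and back;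
        -- distinctness identifies the positions used.
        rcases h₁ with ⟨i, x, y, hx, hy, rfl, rfl⟩ | ⟨i, x, y, hx, hy, rfl, rfl⟩ <;>
          rcases h₂ with ⟨j, x', y', hx', hy', h, h'⟩ | ⟨j, x', y', hx', hy', h, h'⟩ <;>
          cases h <;> cases h'
        · obtain rfl := (List.getElem?_inj (List.getElem?_eq_some_iff.1 hy).1 hH).1 (hy.trans hy'.symm)
          rw [Option.some.inj (hx.symm.trans hx')]
        · obtain rfl := (List.getElem?_inj (List.getElem?_eq_some_iff.1 hx).1 hG).1 (hx.trans hx'.symm)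
          rw [Option.some.inj (hy.symm.trans hy')]
    exact key (Quot.eqvGen_exact h)
  · rintro (rfl | h | h)
    · rfl
    · exact Quot.sound h
    · exact (Quot.sound h).symm

theorem isEmbedding_comp_left (hG : G.right.Nodup) (hH : H.left.Nodup) :
    IsEmbedding G.toHypergraph (G.comp H).toHypergraph (G.compNodeLeft H) (G.compEdgeLeft H) := by
  refine ⟨fun x y h => ?_, Sum.inl_injective, fun _ => rfl, fun _ => rfl, fun _ => rfl,
    fun _ => rfl⟩
  rcases (mk_eq_mk_iff hG hH).1 h with h | ⟨_, _, _, _, _, _, h⟩ | ⟨_, _, _, _, _, _, h⟩ <;> cases h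
  rfl

theorem isEmbedding_comp_right (hG : G.right.Nodup) (hH : H.left.Nodup) :
    IsEmbedding H.toHypergraph (G.comp H).toHypergraph (G.compNodeRight H)
      (G.compEdgeRight H) := by
  refine ⟨fun x y h => ?_, Sum.inr_injective, fun _ => rfl, fun _ => rfl, fun _ => rfl,
    fun _ => rfl⟩
  rcases (mk_eq_mk_iff hG hH).1 h with h | ⟨_, _, _, _, _, h, _⟩ | ⟨_, _, _, _, _, h, _⟩ <;> cases h
  rfl

variable (G H) in
theorem length_right_eq : G.right.length = H.left.length := by
  simpa using congrArg List.length (G.right_label.trans H.left_label.symm)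

variable (G H) in
theorem map_right_eq_map_left :
    G.right.map (G.compNodeLeft H) = H.left.map (G.compNodeRight H) := by
  refine List.ext_getElem (by simpa using length_right_eq G H) fun i h₁ h₂ => ?_
  simp only [List.length_map] at h₁ h₂
  simp only [List.getElem_map]
  exact Quot.sound ⟨i, G.right[i], H.left[i], by simp [h₁], by simp [h₂], rfl, rfl⟩

theorem comp_occurs {s : Term S a b} {t : Term S b c}
    (hs : G.Occurs s Set.univ Set.univ G.left G.right)
    (ht : H.Occurs t Set.univ Set.univ H.left H.right) :
    (G.comp H).Occurs (s.comp t) Set.univ Set.univ (G.comp H).left (G.comp H).right := by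
  have hG := hs.interfaces.2.1.1
  have hH := ht.interfaces.1.1
  have h := ht.map (isEmbedding_comp_right hG hH)
  rw [← map_right_eq_map_left] at h
  refine ⟨_, _, _, _, _, hs.map (isEmbedding_comp_left hG hH), h, ?_, ?_, ?_, ?_⟩
  · refine Set.disjoint_left.2 ?_
    rintro _ ⟨x, -, rfl⟩ ⟨y, -, h⟩
    cases h
  · rintro _ ⟨x, -, rfl⟩ ⟨y, -, h⟩
    rcases (mk_eq_mk_iff hG hH).1 h with h | ⟨_, _, _, _, _, h, _⟩ | ⟨i, x', y', hx, hy, h, h'⟩ <;>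
      cases h
    exact List.mem_map_of_mem (List.mem_of_getElem? hx)
  · refine (Set.eq_univ_of_forall ?_).symm
    rintro (e | e)
    · exact .inl ⟨e, trivial, rfl⟩
    · exact .inr ⟨e, trivial, rfl⟩
  · refine (Set.eq_univ_of_forall ?_).symm
    rintro ⟨e | e⟩
    · exact .inl ⟨e, trivial, rfl⟩
    · exact .inr ⟨e, trivial, rfl⟩

end comp

theorem op_occurs (d : S.Op) :
    (op d).Occurs (Term.op d) Set.univ Set.univ (op d).left (op d).right := by
  refine ⟨(), rfl, Set.eq_univ_of_forall (fun _ => rfl) |>.symm,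
    (Set.eq_univ_of_forall ?_).symm, rfl, rfl, ?_⟩
  · rintro (x | x)
    · exact List.mem_append_left _ (List.mem_map_of_mem (List.mem_finRange x))
    · exact List.mem_append_right _ (List.mem_map_of_mem (List.mem_finRange x))
  · refine List.nodup_append'.2 ⟨(List.nodup_finRange _).map Sum.inl_injective,
      (List.nodup_finRange _).map Sum.inr_injective, fun x hx hx' => ?_⟩
    obtain ⟨y, -, rfl⟩ := List.mem_map.1 hx
    obtain ⟨z, -, h⟩ := List.mem_map.1 hx'
    cases h

theorem idW_occurs (a : List S.Obj) :
    (idW a).Occurs (Term.idW a) Set.univ Set.univ (idW a).left (idW a).right :=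
  Occurs.idW_iff.2 ⟨List.nodup_finRange _, (idW a).left_label,
    (Set.eq_empty_of_forall_notMem (fun e => e.elim)),
    (Set.eq_univ_of_forall List.mem_finRange).symm, rfl⟩

theorem symW_occurs (a b : List S.Obj) :
    (symW a b).Occurs (Term.symW a b) Set.univ Set.univ (symW a b).left (symW a b).right := by
  refine Occurs.symW_iff.2 ⟨_, _, ?_, ?_, ?_, (Set.eq_empty_of_forall_notMem (fun e => e.elim)),
    (Set.eq_univ_of_forall ?_).symm, rfl, rfl⟩
  · simp [symW]
  · simp [symW]
  · refine List.nodup_append'.2 ⟨(List.nodup_finRange _).map Sum.inl_injective,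
      (List.nodup_finRange _).map Sum.inr_injective, fun x hx hx' => ?_⟩
    obtain ⟨y, -, rfl⟩ := List.mem_map.1 hx
    obtain ⟨z, -, h⟩ := List.mem_map.1 hx'
    cases h
  · rintro (x | x)
    · exact List.mem_append_left _ (List.mem_map_of_mem (List.mem_finRange x))
    · exact List.mem_append_right _ (List.mem_map_of_mem (List.mem_finRange x))

end OpenHypergraph

open OpenHypergraph StrDiag.Hypergraph

/-- A term occurs in its interpretation, of which it describes the whole. -/
theorem Term.occurs_interp {a b : List S.Obj} (t : Term S a b) :
    t.interp.Occurs t Set.univ Set.univ t.interp.left t.interp.right := by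
  induction t with
  | op d => exact op_occurs d
  -- The generators `id` and `sym` are traded for `idW [x]` and `symW [x] [y]`, which differ from
  -- them by the laws only.
  | id x => exact (Occurs.par_null_iff (Term.id x)).1 (idW_occurs [x])
  | sym x y =>
    have h : Diagram.mk (Term.symW [x] [y]) = Diagram.mk (Term.sym x y) :=
      Arrow.hom_injective (Arrow.cross_singleton x y)
    exact (Occurs.iff_of_eqv (Quotient.exact h)).1 (symW_occurs [x] [y])
  | null => exact idW_occurs []
  | comp s t ihs iht => exact comp_occurs ihs iht
  | par s t ihs iht => exact par_occurs ihs iht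

/-! ### From occurrences to embeddings of the interpretation -/

/-- Embeddings of the interpretation of a term as a part of a hypergraph. -/
structure OpenHypergraph.EmbedsAs {a b : List S.Obj} (G : OpenHypergraph S a b) (K : Hypergraph S)
    (E : Set K.Edge) (N : Set K.Node) (L M : List K.Node) (f : G.Node → K.Node)
    (g : G.Edge → K.Edge) : Prop extends IsEmbedding G.toHypergraph K f g where
  range_node : Set.range f = N
  range_edge : Set.range g = E
  map_left : G.left.map f = L
  map_right : G.right.map f = M

/-- The list `L` of length `n` as a map on `Fin n`. -/
def nth {α : Type*} {n : ℕ} (L : List α) (h : n = L.length) (i : Fin n) : α := L.get (i.cast h)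

theorem nth_injective {α : Type*} {n : ℕ} {L : List α} (h : n = L.length) (hL : L.Nodup) :
    (nth L h).Injective := by
  subst h
  exact List.nodup_iff_injective_get.1 hL

theorem mem_range_nth {α : Type*} {n : ℕ} {L : List α} (h : n = L.length) {x : α} :
    x ∈ Set.range (nth L h) ↔ x ∈ L := by
  subst h
  exact List.mem_iff_get.symm

theorem map_nth {α : Type*} {n : ℕ} {L : List α} (h : n = L.length) :
    (List.finRange n).map (nth L h) = L := by
  subst h
  exact List.map_get_finRange L

theorem map_map_eq {α β γ : Type*} {f : α → γ} {g : α → β} {h : β → γ} {l : List α}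
    (H : ∀ x, h (g x) = f x) : (l.map g).map h = l.map f := by
  simp [H]

theorem nodeLabel_nth {α β : Type*} {l : α → β} {L : List α} {a : List β} (ha : L.map l = a)
    (h : a.length = L.length) (i : Fin a.length) : l (nth L h i) = a.get i := by
  subst ha
  simp [nth]

namespace OpenHypergraph

variable {K : Hypergraph S} {E E₁ E₂ : Set K.Edge} {N N₁ N₂ : Set K.Node} {L M R : List K.Node}

theorem op_embedsAs {d : S.Op} (h : K.Occurs (Term.op d) E N L M) :
    ∃ f g, (op d).EmbedsAs K E N L M f g := by
  obtain ⟨e, rfl, rfl, rfl, rfl, rfl, hn⟩ := h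
  obtain ⟨h₁, h₂, h₃⟩ := List.nodup_append'.1 hn
  have hl : (S.ar (K.edgeLabel e)).length = (K.src e).length := by
    simpa using (congrArg List.length (K.src_label e)).symm
  have hr : (S.coar (K.edgeLabel e)).length = (K.tgt e).length := by
    simpa using (congrArg List.length (K.tgt_label e)).symm
  have hs : (op (K.edgeLabel e)).left.map (Sum.elim (nth _ hl) (nth _ hr)) = K.src e :=
    (map_map_eq fun _ => rfl).trans (map_nth hl)
  have ht : (op (K.edgeLabel e)).right.map (Sum.elim (nth _ hl) (nth _ hr)) = K.tgt e :=
    (map_map_eq fun _ => rfl).trans (map_nth hr)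
  refine ⟨Sum.elim (nth _ hl) (nth _ hr), fun _ => e, ⟨⟨?_, fun _ _ _ => rfl, ?_, fun _ => rfl,
    fun _ => hs.symm, fun _ => ht.symm⟩, ?_, Set.range_const (ι := Unit), hs, ht⟩⟩
  · refine (nth_injective hl h₁).sumElim (nth_injective hr h₂) fun i j hij => ?_
    exact h₃ ((mem_range_nth hl).1 ⟨i, rfl⟩) ((mem_range_nth hr).1 ⟨j, hij.symm⟩)
  · rintro (i | i)
    · exact nodeLabel_nth (K.src_label e) hl i
    · exact nodeLabel_nth (K.tgt_label e) hr i
  · ext x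
    exact (Set.ext_iff.1 (Set.Sum.elim_range _ _) x).trans <| (or_congr (mem_range_nth hl) (mem_range_nth hr)).trans List.mem_append.symm

theorem idW_embedsAs {a : List S.Obj} (h : K.Occurs (Term.idW a) E N L M) :
    ∃ f g, (idW a).EmbedsAs K E N L M f g := by
  obtain ⟨hn, rfl, rfl, rfl, rfl⟩ := Occurs.idW_iff.1 h
  have hl : (M.map K.nodeLabel).length = M.length := List.length_map _
  refine ⟨nth _ hl, Empty.elim, ⟨⟨nth_injective hl hn, fun e => e.elim, ?_, fun e => e.elim,
    fun e => e.elim, fun e => e.elim⟩, ?_, Set.range_eq_empty (ι := Empty) _, map_nth hl, map_nth hl⟩⟩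
  · exact nodeLabel_nth rfl hl
  · ext x
    exact mem_range_nth hl

theorem symW_embedsAs {a b : List S.Obj} (h : K.Occurs (Term.symW a b) E N L M) :
    ∃ f g, (symW a b).EmbedsAs K E N L M f g := by
  obtain ⟨A, B, rfl, rfl, hn, rfl, rfl, rfl, rfl⟩ := Occurs.symW_iff.1 h
  obtain ⟨h₁, h₂, h₃⟩ := List.nodup_append'.1 hn
  have hl : (A.map K.nodeLabel).length = A.length := List.length_map _
  have hr : (B.map K.nodeLabel).length = B.length := List.length_map _
  refine ⟨Sum.elim (nth _ hl) (nth _ hr), Empty.elim, ⟨⟨?_, fun e => e.elim, ?_, fun e => e.elim,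
    fun e => e.elim, fun e => e.elim⟩, ?_, Set.range_eq_empty (ι := Empty) _, ?_, ?_⟩⟩
  · refine (nth_injective hl h₁).sumElim (nth_injective hr h₂) fun i j hij => ?_
    exact h₃ ((mem_range_nth hl).1 ⟨i, rfl⟩) ((mem_range_nth hr).1 ⟨j, hij.symm⟩)
  · rintro (i | i)
    · exact nodeLabel_nth rfl hl i
    · exact nodeLabel_nth rfl hr i
  · ext x
    exact (Set.ext_iff.1 (Set.Sum.elim_range _ _) x).trans <| (or_congr (mem_range_nth hl) (mem_range_nth hr)).trans List.mem_append.symm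
  · refine List.map_append.trans (congrArg₂ _ ?_ ?_)
    · exact (map_map_eq fun _ => rfl).trans (map_nth hl)
    · exact (map_map_eq fun _ => rfl).trans (map_nth hr)
  · refine List.map_append.trans (congrArg₂ _ ?_ ?_)
    · exact (map_map_eq fun _ => rfl).trans (map_nth hr)
    · exact (map_map_eq fun _ => rfl).trans (map_nth hl)

theorem EmbedsAs.node_mem {a b : List S.Obj} {G : OpenHypergraph S a b} {f : G.Node → K.Node}
    {g : G.Edge → K.Edge} (h : G.EmbedsAs K E N L M f g) (x : G.Node) : f x ∈ N :=
  h.range_node.subset ⟨x, rfl⟩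

theorem EmbedsAs.edge_mem {a b : List S.Obj} {G : OpenHypergraph S a b} {f : G.Node → K.Node}
    {g : G.Edge → K.Edge} (h : G.EmbedsAs K E N L M f g) (e : G.Edge) : g e ∈ E :=
  h.range_edge.subset ⟨e, rfl⟩

theorem EmbedsAs.par {a b a' b' : List S.Obj} {G : OpenHypergraph S a b}
    {H : OpenHypergraph S a' b'} {L' M' : List K.Node} {f₁ : G.Node → K.Node}
    {f₂ : H.Node → K.Node} {g₁ : G.Edge → K.Edge} {g₂ : H.Edge → K.Edge}
    (h₁ : G.EmbedsAs K E₁ N₁ L M f₁ g₁) (h₂ : H.EmbedsAs K E₂ N₂ L' M' f₂ g₂)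
    (hE : Disjoint E₁ E₂) (hN : Disjoint N₁ N₂) :
    (G.par H).EmbedsAs K (E₁ ∪ E₂) (N₁ ∪ N₂) (L ++ L') (M ++ M') (Sum.elim f₁ f₂)
      (Sum.elim g₁ g₂) where
  node_injective := h₁.node_injective.sumElim h₂.node_injective fun x y h =>
    Set.disjoint_left.1 hN (h₁.node_mem x) (h ▸ h₂.node_mem y)
  edge_injective := h₁.edge_injective.sumElim h₂.edge_injective fun x y h =>
    Set.disjoint_left.1 hE (h₁.edge_mem x) (h ▸ h₂.edge_mem y)
  nodeLabel_eq := Sum.rec h₁.nodeLabel_eq h₂.nodeLabel_eq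
  edgeLabel_eq := Sum.rec h₁.edgeLabel_eq h₂.edgeLabel_eq
  src_eq := by
    rintro (e | e)
    · exact (h₁.src_eq e).trans
        (map_map_eq (f := f₁) (g := G.parNodeLeft H) fun _ => rfl).symm
    · exact (h₂.src_eq e).trans
        (map_map_eq (f := f₂) (g := G.parNodeRight H) fun _ => rfl).symm
  tgt_eq := by
    rintro (e | e)
    · exact (h₁.tgt_eq e).trans
        (map_map_eq (f := f₁) (g := G.parNodeLeft H) fun _ => rfl).symm
    · exact (h₂.tgt_eq e).trans
        (map_map_eq (f := f₂) (g := G.parNodeRight H) fun _ => rfl).symm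
  range_node := by rw [← h₁.range_node, ← h₂.range_node]; exact Set.Sum.elim_range _ _
  range_edge := by rw [← h₁.range_edge, ← h₂.range_edge]; exact Set.Sum.elim_range _ _
  map_left := by
    rw [← h₁.map_left, ← h₂.map_left]
    exact List.map_append.trans (congrArg₂ _ (map_map_eq fun _ => rfl) (map_map_eq fun _ => rfl))
  map_right := by
    rw [← h₁.map_right, ← h₂.map_right]
    exact List.map_append.trans (congrArg₂ _ (map_map_eq fun _ => rfl) (map_map_eq fun _ => rfl))

/-- The two maps agree on the middle interface and so descend to the pushout; the descended map is
injective because the parts meet only in `R`, where nodes with equal images have been glued. -/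
theorem EmbedsAs.comp {a b c : List S.Obj} {G : OpenHypergraph S a b}
    {H : OpenHypergraph S b c} {f₁ : G.Node → K.Node}
    {f₂ : H.Node → K.Node} {g₁ : G.Edge → K.Edge} {g₂ : H.Edge → K.Edge}
    (h₁ : G.EmbedsAs K E₁ N₁ L R f₁ g₁) (h₂ : H.EmbedsAs K E₂ N₂ R M f₂ g₂)
    (hE : Disjoint E₁ E₂) (hN : ∀ x ∈ N₁, x ∈ N₂ → x ∈ R) :
    ∃ f, (G.comp H).EmbedsAs K (E₁ ∪ E₂) (N₁ ∪ N₂) L M f (Sum.elim g₁ g₂) := by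
  have hglue : ∀ {x y} {i : ℕ}, G.right[i]? = some x → H.left[i]? = some y → f₁ x = f₂ y := by
    intro x y i hx hy
    have h : R[i]? = some (f₁ x) := by rw [← h₁.map_right, List.getElem?_map, hx]; rfl
    have h' : R[i]? = some (f₂ y) := by rw [← h₂.map_left, List.getElem?_map, hy]; rfl
    exact Option.some.inj (h.symm.trans h')
  have hglue' : ∀ {x y}, f₁ x = f₂ y → Glue G H (Sum.inl x) (Sum.inr y) := by
    intro x y h
    have hR : f₁ x ∈ R :=
      hN _ (h₁.node_mem x) (h ▸ h₂.node_mem y)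
    obtain ⟨i, hi⟩ := List.mem_iff_getElem?.1 hR
    have hi₁ := hi
    have hi₂ := hi
    rw [← h₁.map_right, List.getElem?_map, Option.map_eq_some_iff] at hi₁
    rw [← h₂.map_left, List.getElem?_map, Option.map_eq_some_iff] at hi₂
    obtain ⟨x', hx', e₁⟩ := hi₁
    obtain ⟨y', hy', e₂⟩ := hi₂
    obtain rfl := h₁.node_injective e₁
    obtain rfl := h₂.node_injective (e₂.trans h)
    exact ⟨i, _, _, hx', hy', rfl, rfl⟩
  let f : (G.comp H).Node → K.Node := Quot.lift (Sum.elim f₁ f₂) (by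
    rintro _ _ ⟨i, x, y, hx, hy, rfl, rfl⟩
    exact hglue hx hy)
  refine ⟨f, ⟨⟨?_, ?_, ?_, ?_, ?_, ?_⟩, ?_, ?_, ?_, ?_⟩⟩
  · rintro ⟨x | x⟩ ⟨y | y⟩ h
    · exact congrArg (G.compNodeLeft H) (h₁.node_injective h)
    · exact Quot.sound (hglue' h)
    · exact (Quot.sound (hglue' (Eq.symm h))).symm
    · exact congrArg (G.compNodeRight H) (h₂.node_injective h)
  · exact h₁.edge_injective.sumElim h₂.edge_injective fun x y h =>
      Set.disjoint_left.1 hE (h₁.edge_mem x) (h ▸ h₂.edge_mem y)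
  · rintro ⟨x | x⟩
    · exact h₁.nodeLabel_eq x
    · exact h₂.nodeLabel_eq x
  · exact Sum.rec h₁.edgeLabel_eq h₂.edgeLabel_eq
  · rintro (e | e)
    · exact (h₁.src_eq e).trans
        (map_map_eq (f := f₁) (g := G.compNodeLeft H) fun _ => rfl).symm
    · exact (h₂.src_eq e).trans
        (map_map_eq (f := f₂) (g := G.compNodeRight H) fun _ => rfl).symm
  · rintro (e | e)
    · exact (h₁.tgt_eq e).trans
        (map_map_eq (f := f₁) (g := G.compNodeLeft H) fun _ => rfl).symm
    · exact (h₂.tgt_eq e).trans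
        (map_map_eq (f := f₂) (g := G.compNodeRight H) fun _ => rfl).symm
  · rw [← h₁.range_node, ← h₂.range_node, ← Set.Sum.elim_range]
    exact Set.range_quot_lift _
  · rw [← h₁.range_edge, ← h₂.range_edge]
    exact Set.Sum.elim_range _ _
  · rw [← h₁.map_left]
    exact map_map_eq fun _ => rfl
  · rw [← h₂.map_right]
    exact map_map_eq fun _ => rfl

end OpenHypergraph

/-- A term that occurs in a hypergraph does so through an embedding of its interpretation. -/
theorem Hypergraph.Occurs.exists_embedsAs {K : Hypergraph S} {a b : List S.Obj} {t : Term S a b}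
    {E : Set K.Edge} {N : Set K.Node} {L M : List K.Node} (h : K.Occurs t E N L M) :
    ∃ f g, t.interp.EmbedsAs K E N L M f g := by
  induction t generalizing E N L M with
  | op d => exact op_embedsAs h
  | id x => exact idW_embedsAs ((Occurs.par_null_iff (Term.id x)).2 h)
  | sym x y =>
    have h' : Diagram.mk (Term.symW [x] [y]) = Diagram.mk (Term.sym x y) :=
      Arrow.hom_injective (Arrow.cross_singleton x y)
    exact symW_embedsAs ((Occurs.iff_of_eqv (Quotient.exact h')).2 h)
  | null => exact idW_embedsAs (a := []) h
  | comp s t ihs iht =>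
    obtain ⟨E₁, E₂, N₁, N₂, R, hs, ht, hE, hN, rfl, rfl⟩ := h
    obtain ⟨f₁, g₁, h₁⟩ := ihs hs
    obtain ⟨f₂, g₂, h₂⟩ := iht ht
    obtain ⟨f, h⟩ := h₁.comp h₂ hE hN
    exact ⟨f, _, h⟩
  | par s t ihs iht =>
    obtain ⟨E₁, E₂, N₁, N₂, L₁, L₂, M₁, M₂, hs, ht, hE, hN, rfl, rfl, rfl, rfl⟩ := h
    obtain ⟨f₁, g₁, h₁⟩ := ihs hs
    obtain ⟨f₂, g₂, h₂⟩ := iht ht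
    exact ⟨_, _, h₁.par h₂ hE hN⟩

theorem OpenHypergraph.Iso.isEmbedding {a b : List S.Obj} {G H : OpenHypergraph S a b}
    (i : Iso G H) : IsEmbedding G.toHypergraph H.toHypergraph i.node i.edge :=
  ⟨i.node.injective, i.edge.injective, i.nodeLabel_eq, i.edgeLabel_eq, i.src_eq, i.tgt_eq⟩

/-- An open hypergraph is isomorphic to the interpretation of a term if and only if the term
describes the whole of it. -/
theorem Term.nonempty_iso_iff {a b : List S.Obj} {t : Term S a b} {G : OpenHypergraph S a b} :
    Nonempty (Iso t.interp G) ↔ G.Occurs t Set.univ Set.univ G.left G.right := by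
  constructor
  · rintro ⟨i⟩
    have h := t.occurs_interp.map i.isEmbedding
    rwa [Set.image_univ, Set.image_univ, i.edge.range_eq_univ, i.node.range_eq_univ, ← i.left_eq,
      ← i.right_eq] at h
  · intro h
    obtain ⟨f, g, h⟩ := h.exists_embedsAs
    exact ⟨⟨Equiv.ofBijective f ⟨h.node_injective, Set.range_eq_univ.1 h.range_node⟩,
      Equiv.ofBijective g ⟨h.edge_injective, Set.range_eq_univ.1 h.range_edge⟩, h.nodeLabel_eq,
      h.edgeLabel_eq, h.src_eq, h.tgt_eq, h.map_left.symm, h.map_right.symm⟩⟩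

/-! ### Translation between occurrences and runs -/

namespace Hypergraph

variable {K : Hypergraph S}

theorem append_append_append_perm {α : Type*} (a b c d : List α) :
    ((a ++ b) ++ (c ++ d)).Perm ((a ++ c) ++ (b ++ d)) := by
  simp only [List.append_assoc]
  refine List.Perm.append_left a ?_
  rw [← List.append_assoc, ← List.append_assoc c]
  exact List.perm_append_comm.append_right d

/-- A part of a hypergraph described by a term can be performed one hyperedge after the other,
with the diagram of the term as a result. -/
theorem Occurs.exists_exec {a b : List S.Obj} {t : Term S a b} {E : Set K.Edge}
    {N : Set K.Node} {L M : List K.Node} (h : K.Occurs t E N L M) :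
    ∃ es : List K.Edge, es.Nodup ∧ E = {e | e ∈ es} ∧ (L ++ es.flatMap K.tgt).Nodup ∧
      N = {x | x ∈ L ++ es.flatMap K.tgt} ∧ K.Exec L es M (of t) := by
  induction t generalizing E N L M with
  | op d =>
    obtain ⟨e, rfl, rfl, rfl, rfl, rfl, hn⟩ := h
    refine ⟨[e], by simp, by ext; simp, by simpa using hn, by simp, ?_⟩
    have h₁ : Wiring K.nodeLabel (K.src e) (K.src e ++ []) (wires ((K.src e).map K.nodeLabel)) := by
      simpa using Wiring.refl K.nodeLabel (K.src e)
    have h₂ : K.Exec (K.tgt e ++ []) [] (K.tgt e) (wires ((K.tgt e).map K.nodeLabel)) :=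
      .nil (by simpa using Wiring.refl K.nodeLabel (K.tgt e))
    have h₃ := Exec.cons h₁ h₂
    rw [wires_comp (by simp [dom_step]), comp_wires (by simp [cod_step])] at h₃
    exact (mul_one (of (Term.op (K.edgeLabel e)))) ▸ h₃
  | id x =>
    obtain ⟨p, rfl, rfl, rfl, rfl, rfl⟩ := h
    refine ⟨[], by simp, by simp, by simp, by simp, .nil ?_⟩
    rw [of_id]
    exact Wiring.refl K.nodeLabel [p]
  | sym x y =>
    obtain ⟨p, q, rfl, rfl, hpq, rfl, rfl, rfl, rfl⟩ := h
    refine ⟨[], by simp, by simp, by simpa using hpq, by simp, .nil ?_⟩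
    rw [← cross_singleton]
    exact Wiring.crossing K.nodeLabel [p] [q]
  | null =>
    obtain ⟨rfl, rfl, rfl, rfl⟩ := h
    exact ⟨[], by simp, by simp, by simp, by simp, .nil .nil⟩
  | comp s t ihs iht =>
    obtain ⟨E₁, E₂, N₁, N₂, R, hs, ht, hE, hN, rfl, rfl⟩ := h
    have hR := hs.interfaces.2.1.2
    obtain ⟨es, h₁, rfl, h₂, rfl, h₃⟩ := ihs hs
    obtain ⟨es', h₁', rfl, h₂', rfl, h₃'⟩ := iht ht
    obtain ⟨-, h₄, h₅⟩ := List.nodup_append'.1 h₂'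
    refine ⟨es ++ es', List.nodup_append'.2 ⟨h₁, h₁', Set.disjoint_left.1 hE⟩, by ext; simp, ?_,
      ?_, of_comp s t ▸ h₃.append h₃'⟩
    · rw [List.flatMap_append, ← List.append_assoc]
      -- A target in the second run that belongs to the first part would lie in `R`, against
      -- distinctness in the second run.
      exact List.nodup_append'.2 ⟨h₂, h₄, fun x hx hx' =>
        h₅ (hN x hx (List.mem_append_right _ hx')) hx'⟩
    · ext x
      have := hR x
      rw [List.flatMap_append, ← List.append_assoc]
      simp only [Set.mem_union, Set.mem_ofPred_eq, List.mem_append (s := L ++ es.flatMap K.tgt),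
        List.mem_append (s := R)] at this ⊢
      tauto
  | par s t ihs iht =>
    obtain ⟨E₁, E₂, N₁, N₂, L₁, L₂, M₁, M₂, hs, ht, hE, hN, rfl, rfl, rfl, rfl⟩ := h
    obtain ⟨es, h₁, rfl, h₂, rfl, h₃⟩ := ihs hs
    obtain ⟨es', h₁', rfl, h₂', rfl, h₃'⟩ := iht ht
    have hp := append_append_append_perm L₁ L₂ (es.flatMap K.tgt) (es'.flatMap K.tgt)
    refine ⟨es ++ es', List.nodup_append'.2 ⟨h₁, h₁', Set.disjoint_left.1 hE⟩, by ext; simp, ?_,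
      ?_, ?_⟩
    · rw [List.flatMap_append, hp.nodup_iff]
      exact List.nodup_append'.2 ⟨h₂, h₂', Set.disjoint_left.1 hN⟩
    · ext x
      rw [List.flatMap_append]
      exact List.mem_append.symm.trans hp.mem_iff.symm
    -- The first run is performed beside idle wires for `L₂`, then the second beside those for `M₁`.
    · have h := (h₃.append_right L₂).append (h₃'.append_left M₁)
      rwa [mul_wires_comp_wires_mul h₃.cod_eq h₃'.dom_eq] at h

end Hypergraph

/-- A wiring is a term without operations. The words are existential because `D` is bundled;
`Occurs.interfaces` recovers them as the labels of `L` and `M`. -/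
theorem Wiring.exists_occurs {K : Hypergraph S} {L M : List K.Node} {D : Arrow S}
    (h : Wiring K.nodeLabel L M D) (hL : L.Nodup) :
    ∃ (a b : List S.Obj) (t : Term S a b), of t = D ∧ K.Occurs t ∅ {x | x ∈ L} L M := by
  induction h with
  | nil => exact ⟨_, _, Term.null, rfl, rfl, by simp, rfl, rfl⟩
  | @cons x L M D h ih =>
    obtain ⟨h₁, h₂⟩ := List.nodup_cons.1 hL
    obtain ⟨a, b, t, rfl, ht⟩ := ih h₂
    refine ⟨_, _, (Term.id (K.nodeLabel x)).par t, by rw [of_par, of_id], _, _, _, _, [x], L, [x],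
      M, ⟨x, rfl, rfl, rfl, rfl, rfl⟩, ht, by simp, ?_, by simp, ?_, rfl, rfl⟩
    · simpa using h₁
    · ext; simp
  | swap x y L =>
    simp only [List.nodup_cons, List.mem_cons, not_or] at hL
    refine ⟨_, _, (Term.sym (K.nodeLabel y) (K.nodeLabel x)).par (Term.idW (L.map K.nodeLabel)),
      by rw [of_par, cross_singleton]; rfl, _, _, _, _, [y, x], L, [x, y], L,
      ⟨y, x, rfl, rfl, hL.1.1, rfl, rfl, rfl, rfl⟩,
      Hypergraph.Occurs.idW_iff.2 ⟨hL.2.2, rfl, rfl, rfl, rfl⟩, by simp, ?_, by simp, ?_, rfl, rfl⟩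
    · refine Set.disjoint_left.2 fun z hz hz' => ?_
      rcases List.mem_pair.1 hz with rfl | rfl
      · exact hL.1.2 hz'
      · exact hL.2.1 hz'
    · ext; simp [or_assoc]
  | trans h₁ h₂ ih₁ ih₂ =>
    obtain ⟨a, b, s, rfl, hs⟩ := ih₁ hL
    obtain ⟨b', c, t, rfl, ht⟩ := ih₂ (h₁.perm.nodup_iff.1 hL)
    obtain rfl : b = b' := hs.interfaces.2.2.2.symm.trans ht.interfaces.2.2.1
    refine ⟨_, _, s.comp t, of_comp s t, _, _, _, _, _, hs, ht, by simp, fun x _ hx => hx, by simp,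
      ?_⟩
    ext x
    simp [h₁.perm.mem_iff]

/-- The result of performing hyperedges one after the other is the diagram of a term that describes
the part of the hypergraph involved. -/
theorem Hypergraph.Exec.exists_occurs {K : Hypergraph S} {L M : List K.Node} {es : List K.Edge}
    {D : Arrow S} (h : K.Exec L es M D) (hn : (L ++ es.flatMap K.tgt).Nodup) (hes : es.Nodup) :
    ∃ (a b : List S.Obj) (t : Term S a b), of t = D ∧
      K.Occurs t {e | e ∈ es} {x | x ∈ L ++ es.flatMap K.tgt} L M := by
  induction h with
  | nil h => simpa using h.exists_occurs (by simpa using hn)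
  | @cons L R M e es P D hP h ih =>
    obtain ⟨h₁, h₂⟩ := List.nodup_cons.1 hes
    have hn' := nodup_of_perm hn hP.perm
    obtain ⟨h₃, h₄, h₅⟩ := List.nodup_append'.1 hn'
    obtain ⟨a₁, b₁, p, rfl, hp⟩ := hP.exists_occurs (List.nodup_append'.1 hn).1
    obtain ⟨a₂, b₂, t, rfl, ht⟩ := ih h₄ h₂
    have h₆ := List.nodup_append'.1 (List.nodup_append'.1 h₄).1
    have hs : K.Occurs ((Term.op (K.edgeLabel e)).par (Term.idW (R.map K.nodeLabel)))
        {e} {x | x ∈ K.src e ++ K.tgt e ++ R} (K.src e ++ R) (K.tgt e ++ R) := by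
      refine ⟨_, _, _, _, _, _, _, _, ⟨e, rfl, rfl, rfl, rfl, rfl, ?_⟩,
        Occurs.idW_iff.2 ⟨h₆.2.1, rfl, rfl, rfl, rfl⟩, by simp, ?_, by simp, ?_, rfl, rfl⟩
      · exact List.nodup_append'.2 ⟨h₃, h₆.1, fun x hx hx' => h₅ hx (by simp [hx'])⟩
      · refine Set.disjoint_left.2 fun x hx hx' => ?_
        rcases List.mem_append.1 hx with hx | hx
        · exact h₅ hx (List.mem_append_left _ (List.mem_append_right _ hx'))
        · exact h₆.2.2 hx hx'
      · ext x
        exact List.mem_append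
    obtain rfl : b₁ = S.ar (K.edgeLabel e) ++ R.map K.nodeLabel :=
      hp.interfaces.2.2.2.symm.trans hs.interfaces.2.2.1
    obtain rfl : a₂ = S.coar (K.edgeLabel e) ++ R.map K.nodeLabel :=
      ht.interfaces.2.2.1.symm.trans hs.interfaces.2.2.2
    refine ⟨_, _, p.comp (((Term.op (K.edgeLabel e)).par (Term.idW (R.map K.nodeLabel))).comp t),
      ?_, ∅, _, _, _, _, hp, ⟨_, _, _, _, _, hs, ht, ?_, ?_, rfl,
      rfl⟩, by simp, ?_, ?_, ?_⟩
    · rw [of_comp, of_comp]; rfl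
    · simpa using h₁
    -- The sources of `e` are consumed and do not recur in the rest of the run, so only its targets
    -- and the bystanders are shared.
    · intro x hx hx'
      rw [Set.mem_ofPred_eq, List.append_assoc] at hx
      exact (List.mem_append.1 hx).resolve_left fun hx => h₅ hx hx'
    · exact fun x hx _ => hP.perm.mem_iff.1 hx
    · ext; simp
    · ext x
      simp only [Set.mem_ofPred_eq, Set.mem_union, List.mem_append, hP.perm.mem_iff,
        List.flatMap_cons]
      tauto

/-! ### Degrees and acyclicity -/

open Classical in
theorem card_getElem?_eq {α : Type*} (l : List α) (x : α) :
    Nat.card {i : ℕ // l[i]? = some x} = l.count x := by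
  have h : Nat.card {i : ℕ // l[i]? = some x} =
      ((Finset.range l.length).filter fun i => l[i]? = some x).card := by
    refine Nat.subtype_card _ fun i => ?_
    simp only [Finset.mem_filter, Finset.mem_range, and_iff_right_iff_imp]
    exact fun h => (List.getElem?_eq_some_iff.1 h).1
  rw [h, Finset.card_filter]
  clear h
  induction l with
  | nil => simp
  | cons y l ih =>
    rw [List.length_cons, Finset.sum_range_succ', List.count_cons, ← ih]
    simp

open Classical in
-- Makes degrees into multiplicities in the concatenation of all target (or source) lists, so that
-- monogamy becomes a statement about lists.
theorem card_getElem?_eq_count_flatMap {α β : Type*} (f : α → List β) {l : List α} (hl : l.Nodup)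
    (hl' : ∀ a, a ∈ l) (x : β) :
    Nat.card {p : α × ℕ // (f p.1)[p.2]? = some x} = (l.flatMap f).count x := by
  let _ : Fintype α := ⟨l.toFinset, fun a => by simpa using hl' a⟩
  have hf : ∀ a, Finite {i : ℕ // (f a)[i]? = some x} := fun a =>
    Set.Finite.to_subtype ((Set.finite_lt_nat (f a).length).subset fun i h =>
      (List.getElem?_eq_some_iff.1 h).1)
  rw [Nat.card_congr (Equiv.subtypeProdEquivSigmaSubtype fun a i => (f a)[i]? = some x),
    Nat.card_sigma, List.count_flatMap]
  simp only [card_getElem?_eq]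
  exact List.sum_toFinset _ hl

open Classical in
theorem nodup_append_and_mem_iff {α : Type*} {L F : List α} {c : α → ℕ} (hc : ∀ x, c x = F.count x) :
    ((L ++ F).Nodup ∧ ∀ x, x ∈ L ++ F) ↔
      L.Nodup ∧ (∀ x ∈ L, c x = 0) ∧ ∀ x ∉ L, c x = 1 := by
  simp only [hc]
  constructor
  · rintro ⟨hn, h⟩
    obtain ⟨h₁, h₂, h₃⟩ := List.nodup_append'.1 hn
    refine ⟨h₁, fun x hx => List.count_eq_zero.2 fun hx' => h₃ hx hx', fun x hx => ?_⟩
    exact List.count_eq_one_of_mem h₂ ((List.mem_append.1 (h x)).resolve_left hx)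
  · rintro ⟨h₁, h₂, h₃⟩
    refine ⟨List.nodup_append'.2 ⟨h₁, List.nodup_iff_count_le_one.2 fun x => ?_, fun x hx hx' => ?_⟩,
      fun x => List.mem_append.2 (or_iff_not_imp_left.2 fun hx => ?_)⟩
    · by_cases hx : x ∈ L
      · simp [h₂ x hx]
      · exact (h₃ x hx).le
    · exact List.count_eq_zero.1 (h₂ x hx) hx'
    · exact List.count_pos_iff.1 (by simp [h₃ x hx])

namespace OpenHypergraph

variable {a b : List S.Obj} {G : OpenHypergraph S a b}

theorem monogamous_iff {es : List G.Edge} (hes : es.Nodup) (hes' : ∀ e, e ∈ es) :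
    G.Monogamous ↔ ((G.left ++ es.flatMap G.tgt).Nodup ∧ ∀ x, x ∈ G.left ++ es.flatMap G.tgt) ∧
      (G.right ++ es.flatMap G.src).Nodup ∧ ∀ x, x ∈ G.right ++ es.flatMap G.src := by
  rw [nodup_append_and_mem_iff (c := G.inDegree)
      fun x => card_getElem?_eq_count_flatMap G.tgt hes hes' x,
    nodup_append_and_mem_iff (c := G.outDegree)
      fun x => card_getElem?_eq_count_flatMap G.src hes hes' x]
  constructor
  · rintro ⟨h₁, h₂, h₃, h₄, h₅, h₆⟩
    exact ⟨⟨h₁, h₃, h₄⟩, h₂, h₅, h₆⟩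
  · rintro ⟨⟨h₁, h₃, h₄⟩, h₂, h₅, h₆⟩
    exact ⟨h₁, h₂, h₃, h₄, h₅, h₆⟩

open Classical in
-- The sources of a hyperedge are present when its turn comes, so by distinctness none of them is a
-- target of that hyperedge or of a later one.
theorem idxOf_lt_of_precedes {L M : List G.Node} {es : List G.Edge} {D : Arrow S}
    (h : G.Exec L es M D) (hn : (L ++ es.flatMap G.tgt).Nodup) {e e' : G.Edge} (he : e ∈ es)
    (he' : e' ∈ es) (hp : G.Precedes e e') : es.idxOf e < es.idxOf e' := by
  induction h with
  | nil => simp at he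
  | @cons L R M f es P D hP h ih =>
    obtain ⟨x, hx, hx'⟩ := hp
    have hf : f ≠ e' := by
      rintro rfl
      exact List.disjoint_of_nodup_append hn (hP.perm.symm.subset (List.mem_append_left _ hx'))
        (List.mem_flatMap_of_mem he hx)
    by_cases hf' : f = e
    · subst hf'
      rw [List.idxOf_cons_self, List.idxOf_cons_ne _ hf]
      exact Nat.succ_pos _
    · rw [List.idxOf_cons_ne _ hf, List.idxOf_cons_ne _ hf']
      exact Nat.succ_lt_succ (ih (List.nodup_append'.1 (Hypergraph.Exec.nodup_of_perm hn hP.perm)).2.1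
        (by simpa [Ne.symm hf'] using he) (by simpa [Ne.symm hf] using he'))

theorem acyclic_of_exec {L M : List G.Node} {es : List G.Edge} {D : Arrow S}
    (h : G.Exec L es M D) (hn : (L ++ es.flatMap G.tgt).Nodup) (hes : ∀ e, e ∈ es) :
    G.Acyclic := by
  classical
  intro e he
  have h' := he.lift (p := (· < ·)) es.idxOf fun e e' hp =>
    idxOf_lt_of_precedes h hn (hes e) (hes e') hp
  rw [Relation.transGen_eq_self] at h'
  exact lt_irrefl _ h'

theorem Acyclic.exists_minimal (hG : G.Acyclic) {es : List G.Edge} (hes : es ≠ []) :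
    ∃ e ∈ es, ∀ e' ∈ es, ¬ G.Precedes e' e := by
  have := G.finite_edge
  have : IsTrans G.Edge (Relation.TransGen G.Precedes) := ⟨fun _ _ _ => Relation.TransGen.trans⟩
  have : Std.Irrefl (Relation.TransGen G.Precedes) := ⟨hG⟩
  have hw := Finite.wellFounded_of_trans_of_irrefl (Relation.TransGen G.Precedes)
  obtain ⟨e, he, h⟩ := hw.has_min {e | e ∈ es} (List.exists_mem_of_ne_nil es hes)
  exact ⟨e, he, fun e' he' hp => h e' he' (.single hp)⟩

/-- The hyperedges of an acyclic open hypergraph can be performed in some order. -/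
theorem Acyclic.exists_exec (hG : G.Acyclic) {L M : List G.Node} {es : List G.Edge}
    (hn : (L ++ es.flatMap G.tgt).Nodup)
    (hp : (L ++ es.flatMap G.tgt).Perm (es.flatMap G.src ++ M)) :
    ∃ es' : List G.Edge, es'.Perm es ∧ ∃ D, G.Exec L es' M D := by
  classical
  induction hl : es.length generalizing L es with
  | zero =>
    obtain rfl := List.length_eq_zero_iff.1 hl
    obtain ⟨D, hD⟩ := Wiring.exists_of_perm G.nodeLabel (by simpa using hp)
    exact ⟨[], .nil, D, .nil hD⟩
  | succ n ih =>
    obtain ⟨e, he, hmin⟩ := hG.exists_minimal (List.ne_nil_of_length_eq_add_one hl)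
    have hes := List.perm_cons_erase he
    have hn₁ : (L ++ (e :: es.erase e).flatMap G.tgt).Nodup :=
      ((hes.flatMap_right _).append_left L).nodup_iff.1 hn
    have hp₁ : (L ++ (e :: es.erase e).flatMap G.tgt).Perm
        ((e :: es.erase e).flatMap G.src ++ M) :=
      (((hes.flatMap_right _).append_left L).symm.trans hp).trans
        ((hes.flatMap_right _).append_right M)
    -- By the balance `hp`, a source of `e` is in `L` or is a target of some hyperedge in `es`;
    -- minimality of `e` excludes the latter.
    have hs : G.src e ⊆ L := by
      intro x hx
      refine (List.mem_append.1 (hp.symm.subset (List.mem_append_left _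
        (List.mem_flatMap_of_mem he hx)))).resolve_right fun hx' => ?_
      obtain ⟨e', he', hx'⟩ := List.mem_flatMap.1 hx'
      exact hmin e' he' ⟨x, hx', hx⟩
    have hsn : (G.src e).Nodup := by
      have h := hp₁.nodup_iff.1 hn₁
      rw [List.flatMap_cons, List.append_assoc] at h
      exact (List.nodup_append'.1 h).1
    obtain ⟨R, hR⟩ := exists_perm_append_of_subset hsn hs
    obtain ⟨P, hP⟩ := Wiring.exists_of_perm G.nodeLabel hR
    have hn₂ := (List.nodup_append'.1 (Hypergraph.Exec.nodup_of_perm hn₁ hR)).2.1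
    -- The balance survives the step: cancel the sources of `e` on both sides.
    have hp₂ : (G.tgt e ++ R ++ (es.erase e).flatMap G.tgt).Perm
        ((es.erase e).flatMap G.src ++ M) := by
      refine (List.perm_append_left_iff (G.src e)).1 ?_
      rw [List.flatMap_cons, List.flatMap_cons, List.append_assoc (G.src e)] at hp₁
      refine List.Perm.trans ?_ hp₁
      refine List.Perm.trans ?_ (hR.symm.append_right _)
      rw [List.append_assoc (G.src e) R, ← List.append_assoc R]
      exact (List.perm_append_comm.append_right _).append_left _
    obtain ⟨es', hes', D, hD⟩ := ih hn₂ hp₂ (by rw [List.length_erase_of_mem he, hl]; rfl)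
    exact ⟨e :: es', (hes'.cons e).trans hes.symm, _, .cons hP hD⟩

/-- The open hypergraphs that are interpretations of terms are the monogamous acyclic ones. -/
theorem exists_iso_interp_iff (G : OpenHypergraph S a b) :
    (∃ t : Term S a b, Nonempty (Iso t.interp G)) ↔ G.Monogamous ∧ G.Acyclic := by
  constructor
  · rintro ⟨t, ht⟩
    obtain ⟨es, h₁, h₂, h₃, h₄, h₅⟩ := (Term.nonempty_iso_iff.1 ht).exists_exec
    have h₂' : ∀ e, e ∈ es := fun e => h₂.subset trivial
    have h₄' : ∀ x, x ∈ G.left ++ es.flatMap G.tgt := fun x => h₄.subset trivial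
    -- Conservation of wires carries the exact listing of the nodes from the left interface and
    -- targets to the right interface and sources.
    have hp := h₅.perm.trans List.perm_append_comm
    exact ⟨(monogamous_iff h₁ h₂').2 ⟨⟨h₃, h₄'⟩, hp.nodup_iff.1 h₃, fun x => hp.subset (h₄' x)⟩,
      acyclic_of_exec h₅ h₃ h₂'⟩
  · rintro ⟨hm, hG⟩
    have := G.finite_edge
    let _ := Fintype.ofFinite G.Edge
    have hes : (Finset.univ : Finset G.Edge).toList.Nodup := Finset.nodup_toList _
    have hes' : ∀ e, e ∈ (Finset.univ : Finset G.Edge).toList := by simp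
    obtain ⟨⟨h₁, h₂⟩, h₃, h₄⟩ := (monogamous_iff hes hes').1 hm
    -- Both lists contain every node exactly once, so they are permutations of each other; this is
    -- the balance that a run requires.
    obtain ⟨es, hp, D, hD⟩ := hG.exists_exec h₁ (((List.perm_ext_iff_of_nodup h₁ h₃).2
      fun x => iff_of_true (h₂ x) (h₄ x)).trans List.perm_append_comm)
    have hp' := (hp.flatMap_right G.tgt).append_left G.left
    obtain ⟨a', b', t, -, ht⟩ := hD.exists_occurs (hp'.nodup_iff.2 h₁) (hp.nodup_iff.2 hes)
    obtain rfl : a' = a := ht.interfaces.2.2.1.symm.trans G.left_label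
    obtain rfl : b' = b := ht.interfaces.2.2.2.symm.trans G.right_label
    refine ⟨t, Term.nonempty_iso_iff.2 ?_⟩
    have hE : {e | e ∈ es} = Set.univ := Set.eq_univ_of_forall fun e => hp.symm.subset (hes' e)
    have hN : {x | x ∈ G.left ++ es.flatMap G.tgt} = Set.univ :=
      Set.eq_univ_of_forall fun x => hp'.symm.subset (h₂ x)
    rwa [hE, hN] at ht

end OpenHypergraph

/-! ### Faithfulness of the interpretation -/

open OpenHypergraph

/-- The interpretation is well defined and faithful on string diagrams. -/
theorem Diagram.mk_eq_mk_iff {a b : List S.Obj} {s t : Term S a b} :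
    Diagram.mk s = Diagram.mk t ↔ Hyp.mk s.interp = Hyp.mk t.interp := by
  constructor
  · intro h
    exact Quotient.sound (Term.nonempty_iso_iff.2
      ((Hypergraph.Occurs.iff_of_eqv (Quotient.exact h)).2 t.occurs_interp))
  · intro h
    -- Both terms describe the whole of `t.interp`, so each yields a run through all its hyperedges
    -- between the same interfaces.
    obtain ⟨es, h₁, h₂, h₃, -, h₄⟩ := (Term.nonempty_iso_iff.1 (Quotient.exact h)).exists_exec
    obtain ⟨es', h₁', h₂', -, -, h₄'⟩ := t.occurs_interp.exists_exec
    exact hom_injective (h₄.unique h₄' ((List.perm_ext_iff_of_nodup h₁ h₁').2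
      fun e => iff_of_true (h₂.subset trivial) (h₂'.subset trivial)) h₃)

/-! ### The category of monogamous acyclic open hypergraphs -/

/-- The interpretation of string diagrams. -/
def Diagram.interp {a b : List S.Obj} (f : Diagram S a b) : MonHyp S a b :=
  Quotient.lift (fun t : Term S a b => (⟨Hyp.mk t.interp,
    (exists_iso_interp_iff t.interp).1 ⟨t, ⟨Iso.refl _⟩⟩⟩ : MonHyp S a b))
    (fun _ _ h => Subtype.ext (Diagram.mk_eq_mk_iff.1 (Quotient.sound h))) f

theorem Diagram.interp_bijective (a b : List S.Obj) :
    Function.Bijective (Diagram.interp : Diagram S a b → MonHyp S a b) := by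
  constructor
  · intro f g h
    induction f using Quotient.inductionOn with | h s =>
    induction g using Quotient.inductionOn with | h t =>
    exact Diagram.mk_eq_mk_iff.2 (congrArg Subtype.val h)
  · rintro ⟨f, hf⟩
    induction f using Quotient.inductionOn with | h G =>
    obtain ⟨t, ht⟩ := (exists_iso_interp_iff G).2 hf
    exact ⟨Diagram.mk t, Subtype.ext (Quotient.sound ht)⟩

section transport

variable {A : Type u} {Hom : List A → List A → Type v} {Hom' : List A → List A → Type w}

theorem apply_castHom (F : ∀ a b, Hom a b ≃ Hom' a b) {a a' b b' : List A} (ha : a = a')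
    (hb : b = b') (f : Hom a b) : F a' b' (castHom ha hb f) = castHom ha hb (F a b f) := by
  subst ha hb; rfl

/-- Transport of the structure of a strict symmetric monoidal category along bijections. -/
def StrictSMC.transport (C : StrictSMC Hom) (F : ∀ a b, Hom a b ≃ Hom' a b) : StrictSMC Hom' where
  id a := F _ _ (C.id a)
  comp f g := F _ _ (C.comp ((F _ _).symm f) ((F _ _).symm g))
  tensor f g := F _ _ (C.tensor ((F _ _).symm f) ((F _ _).symm g))
  symm a b := F _ _ (C.symm a b)
  id_comp f := by simp [C.id_comp]
  comp_id f := by simp [C.comp_id]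
  assoc f g h := by simp [C.assoc]
  tensor_id a b := by simp [C.tensor_id]
  interchange f g f' g' := by simp [C.interchange]
  tensor_assoc f g h := by simp [← apply_castHom, C.tensor_assoc]
  id_nil_tensor f := by simp [C.id_nil_tensor]
  tensor_id_nil f := by simp [← apply_castHom, C.tensor_id_nil]
  symm_natural a _ _ f := by simp [C.symm_natural]
  symm_symm a b := by simp [C.symm_symm]
  hexagon a b c := by simp [← apply_castHom, C.hexagon]

/-- The isomorphism onto a transported strict symmetric monoidal category. -/
def StrictSMC.transportIso (C : StrictSMC Hom) (F : ∀ a b, Hom a b ≃ Hom' a b) :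
    StrictSMC.Iso C (C.transport F) where
  map := F
  map_id _ := rfl
  map_comp f g := by simp [transport]
  map_tensor f g := by simp [transport]
  map_symm _ _ := rfl

end transport

/-- With `mk_interp_symW`, identifies the transported identities and symmetries with the discrete
open hypergraphs. -/
theorem Hyp.mk_interp_idW (a : List S.Obj) :
    Hyp.mk (Term.idW a).interp = Hyp.mk (OpenHypergraph.idW a) :=
  Quotient.sound (Term.nonempty_iso_iff.2 (idW_occurs a))

theorem Hyp.mk_interp_symW (a b : List S.Obj) :
    Hyp.mk (Term.symW a b).interp = Hyp.mk (OpenHypergraph.symW a b) :=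
  Quotient.sound (Term.nonempty_iso_iff.2 (symW_occurs a b))

end StrDiag

/-- First two parts: the interpretation is well defined on string diagrams and faithful, and its
image consists of the monogamous acyclic open hypergraphs. Last part: these form a symmetric
monoidal category under the operations of open hypergraphs, and the interpretation is an
isomorphism onto it from the free symmetric monoidal category. -/
theorem mainTheorem2 (S : StrDiag.Signature.{u, v}) :
    (∀ (a b : List S.Obj) (s t : StrDiag.Term S a b),
      StrDiag.Diagram.mk s = StrDiag.Diagram.mk t ↔
        StrDiag.Hyp.mk s.interp = StrDiag.Hyp.mk t.interp) ∧
    (∀ (a b : List S.Obj) (G : StrDiag.OpenHypergraph S a b),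
      (∃ t : StrDiag.Term S a b, Nonempty (StrDiag.OpenHypergraph.Iso t.interp G)) ↔
        G.Monogamous ∧ G.Acyclic) ∧
    ∃ (M : StrDiag.StrictSMC (StrDiag.MonHyp S))
      (F : StrDiag.StrictSMC.Iso (StrDiag.freeSMC S) M),
      (∀ a : List S.Obj, (M.id a).1 = StrDiag.Hyp.mk (StrDiag.OpenHypergraph.idW a)) ∧
      (∀ (a b c : List S.Obj) (f : StrDiag.MonHyp S a b) (g : StrDiag.MonHyp S b c),
        (M.comp f g).1 = f.1.comp g.1) ∧
      (∀ (a b a' b' : List S.Obj) (f : StrDiag.MonHyp S a b) (g : StrDiag.MonHyp S a' b'),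
        (M.tensor f g).1 = f.1.par g.1) ∧
      (∀ a b : List S.Obj,
        (M.symm a b).1 = StrDiag.Hyp.mk (StrDiag.OpenHypergraph.symW a b)) ∧
      (∀ (a b : List S.Obj) (t : StrDiag.Term S a b),
        (F.map a b (StrDiag.Diagram.mk t)).1 = StrDiag.Hyp.mk t.interp) := by
  let F (a b : List S.Obj) : StrDiag.Diagram S a b ≃ StrDiag.MonHyp S a b :=
    Equiv.ofBijective _ (StrDiag.Diagram.interp_bijective a b)
  refine ⟨fun a b s t => StrDiag.Diagram.mk_eq_mk_iff,
    fun a b G => StrDiag.OpenHypergraph.exists_iso_interp_iff G,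
    (StrDiag.freeSMC S).transport F, (StrDiag.freeSMC S).transportIso F,
    StrDiag.Hyp.mk_interp_idW, ?_, ?_, StrDiag.Hyp.mk_interp_symW, fun a b t => rfl⟩
  · intro a b c f g
    -- The transported composition applies `F` to the composite of the preimages. Writing both
    -- arguments as interpretations of terms leaves the clause of `Term.interp` for `comp`, which
    -- holds by definition.
    obtain ⟨f, rfl⟩ := (F a b).surjective f
    obtain ⟨g, rfl⟩ := (F b c).surjective g
    refine (congrArg Subtype.val
      (((StrDiag.freeSMC S).transportIso F).map_comp f g).symm).trans ?_
    induction f using Quotient.inductionOn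
    induction g using Quotient.inductionOn
    rfl
  · intro a b a' b' f g
    obtain ⟨f, rfl⟩ := (F a b).surjective f
    obtain ⟨g, rfl⟩ := (F a' b').surjective g
    refine (congrArg Subtype.val
      (((StrDiag.freeSMC S).transportIso F).map_tensor f g).symm).trans ?_
    induction f using Quotient.inductionOn
    induction g using Quotient.inductionOn
    rfl
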